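/- **Theorem 3.1.** Let $0<T\le\infty$, let $\lambda:[0,T)\to\mathbb R$ belong to $\mathrm{Lip}(1/2)$ with least Hölder constant $\|\lambda\|_{1/2}=c$, and let $h(z,t)$ be the solution of the chordal Löwner equation $$\frac{dh}{dt}=\frac{2}{h-\lambda(t)},\qquad h(z,0)=z .$$ Let $\Omega(t)$ be the set of $z\in\mathbb H=\{\operatorname{Im}z>0\}$ for which the solution exists up to and including time $t$. Suppose that the flow generates quasislit maps: there is a continuous injective curve $\gamma:[0,T)\to\mathbb H\cup\{\lambda(0)\}$ with $\gamma(0)=\lambda(0)$ and $\gamma(t)\in\mathbb H$ for $t>0$, such that $\Omega(t)=\mathbb H\setminus\gamma[0,t]$ for all $t\in[0,T)$ and, for every $t\in(0,T)$, the arc $\gamma[0,t]$ is a quasislit, that is, it is the image of $[0,1]$ under a quasiconformal homeomorphism of the plane and lies in a Stolz angle $\{|\operatorname{Re}z-\lambda(0)|\le M\operatorname{Im}z\}$. Let $I(t)\subset\mathbb R$ be the set corresponding to $\gamma[0,t]$ under the boundary extension of $h(\cdot,t)$ (the set of all real limit values of $h(z,t)$ as $z\in\Omega(t)$ tends to a point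 of $\gamma[0,t]$), and let $h^+(\lambda(0),t)=\sup I(t)$ be its right endpoint. Then $$\limsup_{t\to0+}\frac{h^+(\lambda(0),t)-h^+(\lambda(0),0)}{\sqrt t}\le\frac{c+\sqrt{c^2+16}}{2}.$$ The same bound holds for every right singular solution, that is, for every continuous $x:[0,T)\to\mathbb R$ in place of $h^+(\lambda(0),\cdot)$ that satisfies $x(0)=\lambda(0)$ and, for $0<t<T$, $x(t)>\lambda(t)$ and $x'(t)=2/(x(t)-\lambda(t))$. The bound is sharp: for every $c\ge0$ and $0<T\le\infty$ the driving term $\lambda(t)=c\sqrt t$ on $[0,T)$ has $\|\lambda\|_{1/2}=c$ and generates quasislit maps; the function $\frac{c+\sqrt{c^2+16}}{2}\sqrt t$ is a right singular solution and equals $h^+(\lambda(0),t)$ for all $t\in[0,T)$, so that equality holds in the bound above. -/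

import Mathlib

open Set Filter Topology
open scoped NNReal ENNReal

noncomputable section

/-- The time interval `[0, T)`, where `0 < T ≤ ∞`. -/
def timeInterval (T : ℝ≥0∞) : Set ℝ := {t | 0 ≤ t ∧ ENNReal.ofReal t < T}

/-- `lam ∈ Lip(1/2)` on `[0, T)` with `‖lam‖_{1/2} = c`; the norm is the least Hölder constant. -/
def HasLipHalfNorm (lam : ℝ → ℝ) (T : ℝ≥0∞) (c : ℝ≥0) : Prop :=
  MemHolder (1 / 2) (fun t : timeInterval T => lam t) ∧
    nnHolderNorm (1 / 2) (fun t : timeInterval T => lam t) = c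

/-- `g` solves `dg/ds = 2 / (g - lam(s))`, `g(0) = z`, on the closed interval `[0, t]`; in
particular `g` does not meet `lam` there. -/
structure IsLoewnerTrajectory (lam : ℝ → ℝ) (z : ℂ) (t : ℝ) (g : ℝ → ℂ) : Prop where
  init : g 0 = z
  ne : ∀ s ∈ Icc 0 t, g s ≠ (lam s : ℂ)
  deriv : ∀ s ∈ Icc 0 t, HasDerivWithinAt g (2 / (g s - (lam s : ℂ))) (Icc 0 t) s

/-- `Ω(t)`: the points of the open upper half-plane from which the solution of the Löwner
equation exists up to and including time `t`. -/
def loewnerDomain (lam : ℝ → ℝ) (t : ℝ) : Set ℂ :=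
  {z | 0 < z.im ∧ ∃ g, IsLoewnerTrajectory lam z t g}

open Classical in
/-- The Löwner flow `h(z, t)` (with the value `0` where the solution does not exist up to time
`t`). For continuous `lam` the trajectory starting at `z` is unique on `[0, t]`. -/
def loewnerMap (lam : ℝ → ℝ) (t : ℝ) (z : ℂ) : ℂ :=
  if hz : ∃ g, IsLoewnerTrajectory lam z t g then hz.choose t else 0

/-- Quasiconformal homeomorphism of the plane, by the metric definition: the linear dilatation
`limsup_{r → 0} max_{|w-z|=r} |F w - F z| / min_{|w-z|=r} |F w - F z|` is bounded in `z`. -/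
def IsQuasiconformal (F : ℂ ≃ₜ ℂ) : Prop :=
  ∃ H : ℝ, ∀ z : ℂ, ∀ᶠ r in 𝓝[>] (0 : ℝ), ∀ w w' : ℂ, ‖w - z‖ = r → ‖w' - z‖ = r →
    ‖F w - F z‖ ≤ H * ‖F w' - F z‖

/-- `Γ` is a quasislit rooted at the real point `a`: a quasiconformal image of an interval that
lies within a Stolz angle (of the upper half-plane) with vertex `a`. -/
def IsQuasislit (a : ℝ) (Γ : Set ℂ) : Prop :=
  (a : ℂ) ∈ Γ ∧
    (∃ F : ℂ ≃ₜ ℂ, IsQuasiconformal F ∧ Γ = (fun s : ℝ => F (s : ℂ)) '' Icc 0 1) ∧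
    ∃ M : ℝ, ∀ z ∈ Γ, |z.re - a| ≤ M * z.im

/-- The Löwner equation driven by `lam` generates on `[0, T)` slit maps
`h(·, t) : ℍ \ γ[0, t] → ℍ` for a simple curve `γ` all of whose arcs `γ[0, t]` are quasislits. -/
structure GeneratesQuasislits (lam : ℝ → ℝ) (T : ℝ≥0∞) (γ : ℝ → ℂ) : Prop where
  continuousOn : ContinuousOn γ (timeInterval T)
  injOn : InjOn γ (timeInterval T)
  root : γ 0 = (lam 0 : ℂ)
  im_pos : ∀ t ∈ timeInterval T, 0 < t → 0 < (γ t).im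
  domain_eq : ∀ t ∈ timeInterval T, loewnerDomain lam t = {z : ℂ | 0 < z.im} \ γ '' Icc 0 t
  quasislit : ∀ t ∈ timeInterval T, 0 < t → IsQuasislit (lam 0) (γ '' Icc 0 t)

/-- `I(t)`: the subset of the real line that corresponds to the slit `γ[0, t]` under the boundary
extension of `h(·, t)`, i.e. all real limit values of `h(z, t)` as `z ∈ Ω(t)` approaches a point
of `γ[0, t]`. -/
def slitImage (lam : ℝ → ℝ) (γ : ℝ → ℂ) (t : ℝ) : Set ℝ :=
  {x | ∃ p ∈ γ '' Icc 0 t, MapClusterPt (x : ℂ) (𝓝[loewnerDomain lam t] p) (loewnerMap lam t)}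

/-- The right endpoint `h⁺(lam(0), t)` of `I(t)`. -/
def rightEndpoint (lam : ℝ → ℝ) (γ : ℝ → ℂ) (t : ℝ) : ℝ := sSup (slitImage lam γ t)

/-- `x` is a right singular solution on `[0, T)`: it is continuous for `t ≥ 0`, starts at the
singular point `x(0) = lam(0)`, and for `t > 0` it lies to the right of `lam(t)` and solves
`dx/dt = 2 / (x - lam(t))`. -/
structure IsRightSingularSolution (lam : ℝ → ℝ) (T : ℝ≥0∞) (x : ℝ → ℝ) : Prop where
  continuousOn : ContinuousOn x (timeInterval T)
  init : x 0 = lam 0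
  lt : ∀ t ∈ timeInterval T, 0 < t → lam t < x t
  deriv : ∀ t ∈ timeInterval T, 0 < t → HasDerivAt x (2 / (x t - lam t)) t

/-- `limsup_{t → 0+} (x(t) - x(0)) / √t`, as an extended real number. -/
def sqrtGrowth (x : ℝ → ℝ) : EReal :=
  limsup (fun t : ℝ => (((x t - x 0) / √t : ℝ) : EReal)) (𝓝[>] 0)

end

/-! ### Trajectories of the Löwner equation -/

/-! Write a = `growthConst c`, the positive root of a(a - c) = 4. Then a√t solves x' = 2/(x - c√t),
so it is the singular solution for the extreme driving term. The only consequence of the Hölder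
condition used for the upper bound is |λ(t) - λ(0)| ≤ c√t. It makes λ(0) + a√t + ε a strict barrier:
on contact, x - λ exceeds (a - c)√t, so x moves more slowly than the barrier (`sqrt_comparison`).
The barrier stops right singular solutions, and also real parts of complex trajectories, since an
imaginary part only slows the motion to the right.

For the right endpoint, consider z near γ(s). If s = 0, z starts below the barrier. If s > 0, the
trajectory of γ(s) dies by time s, hence comes arbitrarily close to λ at some earlier time r; by
continuous dependence the trajectory of z is then near λ(r), again below the barrier. So every limit
value in I(t) is at most λ(0) + a√t (`le_of_mem_slitImage`), for all t and not merely as t → 0.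

For λ = c√t the flow is integrable: with suitable positive weights α + β = 1, α log(w - a√t) + β
log(w + (a - c)√t) is conserved and equals log z at time 0. Its real and imaginary parts give |z|
and arg z in terms of w. At absorption w = c√t, which forces z onto a fixed ray. Conversely, the law
of sines and strict concavity of sine show that a point of the ray cannot survive its absorption
time. Finally w → a√t forces z → 0, so a√t lies in I(t) and the bound is attained. -/

theorem loewner_rhs_im (w : ℂ) (l : ℝ) :
    (2 / (w - (l : ℂ))).im = -(2 / ‖w - (l : ℂ)‖ ^ 2) * w.im := by
  rw [Complex.div_im, Complex.normSq_eq_norm_sq]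
  simp
  ring

theorem loewner_rhs_re (w : ℂ) (l : ℝ) :
    (2 / (w - (l : ℂ))).re = 2 / ‖w - (l : ℂ)‖ ^ 2 * (w.re - l) := by
  rw [Complex.div_re, Complex.normSq_eq_norm_sq]
  simp
  ring

theorem HasDerivWithinAt.complex_im {g : ℝ → ℂ} {g' : ℂ} {s : Set ℝ} {u : ℝ}
    (h : HasDerivWithinAt g g' s u) : HasDerivWithinAt (fun v => (g v).im) g'.im s u :=
  (Complex.imCLM.hasFDerivAt.comp_hasDerivWithinAt u h)

theorem HasDerivWithinAt.complex_re {g : ℝ → ℂ} {g' : ℂ} {s : Set ℝ} {u : ℝ}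
    (h : HasDerivWithinAt g g' s u) : HasDerivWithinAt (fun v => (g v).re) g'.re s u :=
  (Complex.reCLM.hasFDerivAt.comp_hasDerivWithinAt u h)

theorem HasDerivWithinAt.Ici_of_Icc {E : Type*} [NormedAddCommGroup E] [NormedSpace ℝ E]
    {g : ℝ → E} {g' : E} {a b u : ℝ} (h : HasDerivWithinAt g g' (Icc a b) u) (hu : u ∈ Ico a b) :
    HasDerivWithinAt g g' (Ici u) u :=
  h.mono_of_mem_nhdsWithin (mem_of_superset (Icc_mem_nhdsGE hu.2) (Icc_subset_Icc_left hu.1))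

namespace IsLoewnerTrajectory

variable {lam : ℝ → ℝ} {z : ℂ} {t : ℝ} {g : ℝ → ℂ}

theorem continuousOn (hg : IsLoewnerTrajectory lam z t g) : ContinuousOn g (Icc 0 t) :=
  fun s hs => (hg.deriv s hs).continuousWithinAt

theorem restrict (hg : IsLoewnerTrajectory lam z t g) {s : ℝ} (hs : s ≤ t) :
    IsLoewnerTrajectory lam z s g where
  init := hg.init
  ne u hu := hg.ne u ⟨hu.1, hu.2.trans hs⟩
  deriv u hu := (hg.deriv u ⟨hu.1, hu.2.trans hs⟩).mono (Icc_subset_Icc_right hs)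

/-- Im g decays at relative rate 2/|g - λ|², at most 2/δ², so the square of Im g times exp(4u/δ²)
increases. Squaring removes the need to know the sign of Im g, which `im_pos` deduces from this
bound. -/
theorem im_sq_ge (hg : IsLoewnerTrajectory lam z t g) {δ : ℝ} (hδ : 0 < δ)
    (hd : ∀ s ∈ Icc 0 t, δ ≤ ‖g s - (lam s : ℂ)‖) {s : ℝ} (hs : s ∈ Icc 0 t) :
    z.im ^ 2 * Real.exp (-(4 / δ ^ 2 * s)) ≤ (g s).im ^ 2 := by
  have hmono : MonotoneOn (fun u => (g u).im ^ 2 * Real.exp (4 / δ ^ 2 * u)) (Icc 0 t) := by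
    refine monotoneOn_of_hasDerivWithinAt_nonneg (convex_Icc 0 t)
      (f' := fun u => 2 * (g u).im * (2 / (g u - (lam u : ℂ))).im * Real.exp (4 / δ ^ 2 * u) +
        (g u).im ^ 2 * (Real.exp (4 / δ ^ 2 * u) * (4 / δ ^ 2))) ?_ ?_ ?_
    · exact ((Complex.continuous_im.comp_continuousOn hg.continuousOn).pow 2).mul
        (by fun_prop)
    · intro u hu
      have h1 := ((hg.deriv u (interior_subset hu)).mono interior_subset).complex_im
      have h2 : HasDerivAt (fun u => Real.exp (4 / δ ^ 2 * u))
          (Real.exp (4 / δ ^ 2 * u) * (4 / δ ^ 2)) u := by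
        simpa using ((hasDerivAt_id u).const_mul (4 / δ ^ 2)).exp
      exact ((h1.pow 2).mul h2.hasDerivWithinAt).congr_deriv (by simp)
    · intro u hu
      have hd' := hd u (interior_subset hu)
      rw [loewner_rhs_im]
      have h3 : 2 / ‖g u - (lam u : ℂ)‖ ^ 2 ≤ 2 / δ ^ 2 := by gcongr
      have h4 : 4 / δ ^ 2 = 2 * (2 / δ ^ 2) := by ring
      rw [h4]
      have : 0 ≤ 2 * Real.exp (2 * (2 / δ ^ 2) * u) * (g u).im ^ 2 *
          (2 / δ ^ 2 - 2 / ‖g u - (lam u : ℂ)‖ ^ 2) :=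
        mul_nonneg (by positivity) (sub_nonneg.2 h3)
      linarith
  have h0 := hmono (left_mem_Icc.2 (hs.1.trans hs.2)) hs hs.1
  simp only [mul_zero, Real.exp_zero, mul_one, hg.init] at h0
  calc _ ≤ (g s).im ^ 2 * Real.exp (4 / δ ^ 2 * s) * Real.exp (-(4 / δ ^ 2 * s)) := by gcongr
    _ = _ := by rw [mul_assoc, ← Real.exp_add]; simp

theorem exists_dist_ge (hg : IsLoewnerTrajectory lam z t g) (hlam : ContinuousOn lam (Icc 0 t)) :
    ∃ δ > 0, ∀ s ∈ Icc 0 t, δ ≤ ‖g s - (lam s : ℂ)‖ := by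
  have hc : ContinuousOn (fun s => ‖g s - (lam s : ℂ)‖) (Icc 0 t) :=
    (hg.continuousOn.sub (Complex.continuous_ofReal.comp_continuousOn hlam)).norm
  rcases (Icc (0 : ℝ) t).eq_empty_or_nonempty with he | hne
  · exact ⟨1, one_pos, by simp [he]⟩
  · obtain ⟨u, hu, hmin⟩ := isCompact_Icc.exists_isMinOn hne hc
    exact ⟨_, norm_pos_iff.2 (sub_ne_zero.2 (hg.ne u hu)), fun s hs => hmin hs⟩

theorem im_pos (hg : IsLoewnerTrajectory lam z t g) (hlam : ContinuousOn lam (Icc 0 t))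
    (hz : 0 < z.im) {s : ℝ} (hs : s ∈ Icc 0 t) : 0 < (g s).im := by
  obtain ⟨δ, hδ, hd⟩ := hg.exists_dist_ge hlam
  by_contra! hneg
  have hc : ContinuousOn (fun u => (g u).im) (Icc 0 s) :=
    Complex.continuous_im.comp_continuousOn (hg.restrict hs.2).continuousOn
  obtain ⟨u, hu, hu0⟩ := intermediate_value_Icc' hs.1 hc
    (show (0 : ℝ) ∈ Icc (g s).im (g 0).im from ⟨hneg, by rw [hg.init]; exact hz.le⟩)
  have := hg.im_sq_ge hδ hd ⟨hu.1, hu.2.trans hs.2⟩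
  simp only at hu0
  rw [hu0] at this
  have h2 : 0 < z.im ^ 2 * Real.exp (-(4 / δ ^ 2 * u)) := by positivity
  linarith

theorem im_antitone (hg : IsLoewnerTrajectory lam z t g) (hlam : ContinuousOn lam (Icc 0 t))
    (hz : 0 < z.im) : AntitoneOn (fun s => (g s).im) (Icc 0 t) := by
  refine antitoneOn_of_hasDerivWithinAt_nonpos (convex_Icc 0 t)
    (Complex.continuous_im.comp_continuousOn hg.continuousOn)
    (fun u hu => ((hg.deriv u (interior_subset hu)).mono interior_subset).complex_im) ?_
  intro u hu
  rw [loewner_rhs_im]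
  have := hg.im_pos hlam hz (interior_subset hu)
  have h2 : 0 ≤ 2 / ‖g u - (lam u : ℂ)‖ ^ 2 * (g u).im := by positivity
  linarith

end IsLoewnerTrajectory

/-! ### Uniqueness and continuous dependence -/

theorem im_le_norm_sub_ofReal (w : ℂ) (l : ℝ) : w.im ≤ ‖w - (l : ℂ)‖ := by
  simpa using (le_abs_self _).trans (Complex.abs_im_le_norm (w - (l : ℂ)))

theorem norm_loewner_rhs_sub_le {m : ℝ} (hm : 0 < m) {w w' : ℂ} (hw : m ≤ w.im) (hw' : m ≤ w'.im)
    (l : ℝ) : ‖2 / (w - (l : ℂ)) - 2 / (w' - (l : ℂ))‖ ≤ 2 / m ^ 2 * ‖w - w'‖ := by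
  have h1 := hw.trans (im_le_norm_sub_ofReal w l)
  have h2 := hw'.trans (im_le_norm_sub_ofReal w' l)
  have n1 : w - (l : ℂ) ≠ 0 := norm_pos_iff.1 (hm.trans_le h1)
  have n2 : w' - (l : ℂ) ≠ 0 := norm_pos_iff.1 (hm.trans_le h2)
  have : 2 / (w - (l : ℂ)) - 2 / (w' - (l : ℂ)) =
      2 * (w' - w) / ((w - (l : ℂ)) * (w' - (l : ℂ))) := by
    field_simp
    ring
  rw [this, norm_div, norm_mul, norm_mul, norm_sub_rev w' w, mul_comm (2 / m ^ 2), ← mul_div_assoc,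
    mul_comm ‖w - w'‖, sq]
  simp only [Complex.norm_ofNat]
  gcongr

theorem lipschitzOnWith_loewner_rhs {m : ℝ} (hm : 0 < m) (l : ℝ) :
    LipschitzOnWith (2 / m ^ 2).toNNReal (fun w : ℂ => 2 / (w - (l : ℂ))) {w | m ≤ w.im} := by
  refine LipschitzOnWith.of_dist_le_mul fun w hw w' hw' => ?_
  rw [Real.coe_toNNReal _ (by positivity), dist_eq_norm, dist_eq_norm]
  exact norm_loewner_rhs_sub_le hm hw hw' l

namespace IsLoewnerTrajectory

variable {lam : ℝ → ℝ} {z w : ℂ} {t : ℝ} {g k : ℝ → ℂ}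

theorem dist_le (hg : IsLoewnerTrajectory lam z t g) (hk : IsLoewnerTrajectory lam w t k) {m : ℝ}
    (hm : 0 < m) (hgm : ∀ s ∈ Icc 0 t, m ≤ (g s).im) (hkm : ∀ s ∈ Icc 0 t, m ≤ (k s).im)
    {s : ℝ} (hs : s ∈ Icc 0 t) : dist (g s) (k s) ≤ dist z w * Real.exp (2 / m ^ 2 * s) := by
  have := dist_le_of_trajectories_ODE_of_mem (v := fun s w => 2 / (w - (lam s : ℂ)))
    (s := fun _ => {w | m ≤ w.im}) (δ := dist z w)
    (fun s _ => lipschitzOnWith_loewner_rhs hm (lam s)) hg.continuousOn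
    (fun u hu => (hg.deriv u (Ico_subset_Icc_self hu)).Ici_of_Icc hu)
    (fun u hu => hgm u (Ico_subset_Icc_self hu)) hk.continuousOn
    (fun u hu => (hk.deriv u (Ico_subset_Icc_self hu)).Ici_of_Icc hu)
    (fun u hu => hkm u (Ico_subset_Icc_self hu)) (by rw [hg.init, hk.init]) s hs
  rwa [Real.coe_toNNReal _ (by positivity), sub_zero] at this

theorem eqOn (hg : IsLoewnerTrajectory lam z t g) (hk : IsLoewnerTrajectory lam z t k)
    (hlam : ContinuousOn lam (Icc 0 t)) (hz : 0 < z.im) : EqOn g k (Icc 0 t) := by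
  intro s hs
  have ht := right_mem_Icc.2 (hs.1.trans hs.2)
  have := hg.dist_le hk (lt_min (hg.im_pos hlam hz ht) (hk.im_pos hlam hz ht))
    (fun u hu => (min_le_left _ _).trans (hg.im_antitone hlam hz hu ht hu.2))
    (fun u hu => (min_le_right _ _).trans (hk.im_antitone hlam hz hu ht hu.2)) hs
  rw [dist_self, zero_mul] at this
  exact dist_le_zero.1 this

theorem loewnerMap_eq (hg : IsLoewnerTrajectory lam z t g) (hlam : ContinuousOn lam (Icc 0 t))
    (hz : 0 < z.im) (ht : 0 ≤ t) : loewnerMap lam t z = g t := by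
  have hex : ∃ g, IsLoewnerTrajectory lam z t g := ⟨g, hg⟩
  rw [loewnerMap, dif_pos hex]
  exact hex.choose_spec.eqOn hg hlam hz (right_mem_Icc.2 ht)

/-- Continuous dependence of the flow on the initial point. -/
theorem exists_forall_dist_lt (hg : IsLoewnerTrajectory lam z t g)
    (hlam : ContinuousOn lam (Icc 0 t)) (hz : 0 < z.im) (ht : 0 ≤ t) {ε : ℝ} (hε : 0 < ε) :
    ∃ δ > 0, ∀ w k, 0 < w.im → dist w z < δ → IsLoewnerTrajectory lam w t k →
      dist (k t) (g t) < ε := by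
  have htm := right_mem_Icc.2 ht
  have hpos := hg.im_pos hlam hz htm
  set m := (g t).im / 2 with hmdef
  have hm : 0 < m := by positivity
  have hgm : ∀ s ∈ Icc 0 t, 2 * m ≤ (g s).im := fun s hs => by
    have := hg.im_antitone hlam hz hs htm hs.2
    simp only at this
    linarith
  set E := Real.exp (2 / m ^ 2 * t) with hE
  have hEpos : 0 < E := Real.exp_pos _
  refine ⟨min ε m / E, div_pos (lt_min hε hm) hEpos, fun w k hw hwz hk => ?_⟩
  -- Since Im k decreases, height m at time s gives height m on all of [0, s], where Grönwall
  -- applies with Lipschitz constant 2/m².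
  have key : ∀ s ∈ Icc 0 t, m ≤ (k s).im → dist (k s) (g s) < min ε m := fun s hs hks => by
    have hl : ContinuousOn lam (Icc 0 s) := hlam.mono (Icc_subset_Icc_right hs.2)
    have h1 := (hk.restrict hs.2).dist_le (hg.restrict hs.2) hm
      (fun u hu => hks.trans ((hk.restrict hs.2).im_antitone hl hw hu
        (right_mem_Icc.2 hs.1) hu.2))
      (fun u hu => by linarith [hgm u ⟨hu.1, hu.2.trans hs.2⟩]) (right_mem_Icc.2 hs.1)
    have h2 : Real.exp (2 / m ^ 2 * s) ≤ E := by
      rw [hE]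
      have := hs.2
      gcongr
    calc _ ≤ _ := h1
      _ ≤ dist w z * E := by gcongr
      _ < min ε m / E * E := by gcongr
      _ = _ := by field_simp
  -- Bootstrap: if k ended below height m, it would cross m at some time when g is at height at
  -- least 2m, yet less than m away.
  refine (key t htm ?_).trans_le (min_le_left _ _)
  by_contra! hlt
  have hc : ContinuousOn (fun u => (k u).im) (Icc 0 t) :=
    Complex.continuous_im.comp_continuousOn hk.continuousOn
  by_cases h0 : m ≤ (k 0).im
  · obtain ⟨u, hu, hum⟩ := intermediate_value_Icc' ht hc ⟨hlt.le, h0⟩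
    have h1 := (key u hu hum.ge).trans_le (min_le_right _ _)
    have h2 := hgm u hu
    have h3 := (Complex.abs_im_le_norm (k u - g u)).trans_lt (by rwa [dist_eq_norm] at h1)
    rw [Complex.sub_im, abs_lt] at h3
    simp only at hum
    linarith
  · have h2 := hgm 0 (left_mem_Icc.2 ht)
    rw [hg.init] at h2
    rw [hk.init] at h0
    have hE1 : 1 ≤ E := Real.one_le_exp (by positivity)
    have h1 : dist w z < m := hwz.trans_le ((div_le_self (lt_min hε hm).le hE1).trans
      (min_le_right _ _))
    have h3 := (Complex.abs_im_le_norm (w - z)).trans_lt (by rwa [dist_eq_norm] at h1)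
    rw [Complex.sub_im, abs_lt] at h3
    linarith

end IsLoewnerTrajectory

/-! ### Existence of trajectories -/

/-- The projection of the plane onto the half-plane `m ≤ Im w`. -/
noncomputable def projHalfPlane (m : ℝ) (w : ℂ) : ℂ := ⟨w.re, max w.im m⟩

theorem norm_projHalfPlane_sub_le (m : ℝ) (w w' : ℂ) :
    ‖projHalfPlane m w - projHalfPlane m w'‖ ≤ ‖w - w'‖ := by
  rw [← abs_of_nonneg (norm_nonneg (w - w')), ← abs_of_nonneg (norm_nonneg (_ - _)), ← sq_le_sq,
    ← Complex.normSq_eq_norm_sq, ← Complex.normSq_eq_norm_sq, Complex.normSq_apply,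
    Complex.normSq_apply]
  simp only [projHalfPlane, Complex.sub_re, Complex.sub_im]
  have := abs_max_sub_max_le_abs w.im w'.im m
  nlinarith [sq_le_sq.2 this]

theorem projHalfPlane_of_le {m : ℝ} {w : ℂ} (h : m ≤ w.im) : projHalfPlane m w = w := by
  apply Complex.ext <;> simp [projHalfPlane, h]

/-- The Löwner equation with the right-hand side cut off near the real axis is solvable. -/
theorem exists_cutoff_solution {lam : ℝ → ℝ} {t : ℝ} (hlam : ContinuousOn lam (Icc 0 t)) {m : ℝ}
    (hm : 0 < m) (w : ℂ) {t₀ : ℝ} (ht₀ : t₀ ∈ Icc 0 t) :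
    ∃ g : ℝ → ℂ, g t₀ = w ∧ ∀ s ∈ Icc 0 t,
      HasDerivWithinAt g (2 / (projHalfPlane m (g s) - (lam s : ℂ))) (Icc 0 t) s := by
  have him : ∀ w, m ≤ (projHalfPlane m w).im := fun w => le_max_right _ _
  have hge : ∀ w (l : ℝ), m ≤ ‖projHalfPlane m w - (l : ℂ)‖ := fun w l =>
    (him w).trans (im_le_norm_sub_ofReal _ l)
  have ht : 0 ≤ t := ht₀.1.trans ht₀.2
  -- The cut-off field is globally Lipschitz and bounded by 2/m, so a ball of radius (2/m)t holds
  -- the solution over the whole interval and no continuation is needed.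
  have hP : IsPicardLindelof (fun s w => 2 / (projHalfPlane m w - (lam s : ℂ))) ⟨t₀, ht₀⟩ w
      (2 / m * t).toNNReal 0 (2 / m).toNNReal (2 / m ^ 2).toNNReal := by
    refine ⟨fun s _ => LipschitzOnWith.of_dist_le_mul fun x _ y _ => ?_, fun x _ => ?_,
      fun s _ x _ => ?_, ?_⟩
    · rw [Real.coe_toNNReal _ (by positivity), dist_eq_norm, dist_eq_norm]
      refine (norm_loewner_rhs_sub_le hm (him x) (him y) _).trans ?_
      gcongr
      exact norm_projHalfPlane_sub_le m x y
    · refine continuousOn_const.div (continuousOn_const.sub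
        (Complex.continuous_ofReal.comp_continuousOn hlam)) fun s _ => ?_
      exact norm_pos_iff.1 (hm.trans_le (hge x _))
    · rw [Real.coe_toNNReal _ (by positivity), norm_div, Complex.norm_ofNat]
      gcongr
      exact hge x _
    · rw [Real.coe_toNNReal _ (by positivity), Real.coe_toNNReal _ (by positivity)]
      simp only [NNReal.coe_zero, sub_zero]
      gcongr
      have := ht₀.1
      have := ht₀.2
      exact max_le (by linarith) (by linarith)
  exact hP.exists_eq_forall_mem_Icc_hasDerivWithinAt₀

/-- Every point of the half-plane is reached by the flow at any given time. -/
theorem exists_trajectory_ending_at {lam : ℝ → ℝ} {t : ℝ} (hlam : ContinuousOn lam (Icc 0 t))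
    (ht : 0 ≤ t) {w : ℂ} (hw : 0 < w.im) :
    ∃ z g, 0 < z.im ∧ IsLoewnerTrajectory lam z t g ∧ g t = w := by
  -- Solve backwards from w with the cutoff at height Im w. Heights decrease in time, so earlier
  -- points are higher and the cutoff is never active.
  obtain ⟨g, hgt, hg⟩ := exists_cutoff_solution hlam hw w (right_mem_Icc.2 ht)
  have hanti : AntitoneOn (fun s => (g s).im) (Icc 0 t) := by
    refine antitoneOn_of_hasDerivWithinAt_nonpos (convex_Icc 0 t)
      (Complex.continuous_im.comp_continuousOn fun s hs => (hg s hs).continuousWithinAt)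
      (fun u hu => ((hg u (interior_subset hu)).mono interior_subset).complex_im) ?_
    intro u hu
    rw [loewner_rhs_im]
    have : 0 < (projHalfPlane w.im (g u)).im := hw.trans_le (le_max_right _ _)
    have h2 : 0 ≤ 2 / ‖projHalfPlane w.im (g u) - (lam u : ℂ)‖ ^ 2 *
      (projHalfPlane w.im (g u)).im := by positivity
    linarith
  have him : ∀ s ∈ Icc 0 t, w.im ≤ (g s).im := fun s hs => by
    simpa [hgt] using hanti hs (right_mem_Icc.2 ht) hs.2
  refine ⟨g 0, g, hw.trans_le (him 0 (left_mem_Icc.2 ht)), ⟨rfl, fun s hs h => ?_, fun s hs => ?_⟩,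
    hgt⟩
  · have := him s hs
    rw [h, Complex.ofReal_im] at this
    linarith
  · have := hg s hs
    rwa [projHalfPlane_of_le (him s hs)] at this

/-- A trajectory that cannot be continued up to time `t` comes close to the driving term. -/
theorem exists_trajectory_near_driving {lam : ℝ → ℝ} {z : ℂ} {t : ℝ}
    (hlam : ContinuousOn lam (Icc 0 t)) (ht : 0 ≤ t) (hz : 0 < z.im)
    (hno : ¬ ∃ g, IsLoewnerTrajectory lam z t g) {ε : ℝ} (hε : 0 < ε) :
    ∃ s ∈ Ico 0 t, ∃ g, IsLoewnerTrajectory lam z s g ∧ ‖g s - (lam s : ℂ)‖ < ε := by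
  by_contra! hcon
  have hfar : ∀ s ∈ Ico 0 t, ∀ g, IsLoewnerTrajectory lam z s g →
      z.im * Real.exp (-(2 / ε ^ 2 * t)) ≤ (g s).im := fun s hs g hg => by
    have hl : ContinuousOn lam (Icc 0 s) := hlam.mono (Icc_subset_Icc_right hs.2.le)
    have h1 := hg.im_sq_ge hε (fun u hu => hcon u ⟨hu.1, hu.2.trans_lt hs.2⟩ g (hg.restrict hu.2))
      (right_mem_Icc.2 hs.1)
    have h2 : (z.im * Real.exp (-(2 / ε ^ 2 * t))) ^ 2 ≤ z.im ^ 2 * Real.exp (-(4 / ε ^ 2 * s)) := by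
      rw [mul_pow, ← Real.exp_nat_mul]
      have h3 : ((2 : ℕ) : ℝ) * -(2 / ε ^ 2 * t) = -(4 / ε ^ 2 * t) := by push_cast; ring
      rw [h3]
      have := hs.2.le
      gcongr
    exact (pow_le_pow_iff_left₀ (by positivity)
      (hg.im_pos hl hz (right_mem_Icc.2 hs.1)).le two_ne_zero).1 (h2.trans h1)
  -- Half the a priori lower bound `hfar`: at a first descent to height m the cut-off solution would
  -- still be a true trajectory, hence at height at least 2m.
  set m := z.im * Real.exp (-(2 / ε ^ 2 * t)) / 2 with hmdef
  have hm : 0 < m := by positivity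
  obtain ⟨g, hg0, hg⟩ := exists_cutoff_solution hlam hm z (left_mem_Icc.2 ht)
  have hgc : ContinuousOn g (Icc 0 t) := fun s hs => (hg s hs).continuousWithinAt
  have hic : ContinuousOn (fun s => (g s).im) (Icc 0 t) :=
    Complex.continuous_im.comp_continuousOn hgc
  have htraj : ∀ s ∈ Icc 0 t, (∀ u ∈ Icc 0 s, m ≤ (g u).im) → IsLoewnerTrajectory lam z s g := by
    intro s hs hle
    refine ⟨hg0, fun u hu h => ?_, fun u hu => ?_⟩
    · have := hle u hu
      rw [h, Complex.ofReal_im] at this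
      linarith
    · have := (hg u ⟨hu.1, hu.2.trans hs.2⟩).mono (Icc_subset_Icc_right hs.2)
      rwa [projHalfPlane_of_le (hle u hu)] at this
  have hz2 : 2 * m ≤ z.im := by
    have : Real.exp (-(2 / ε ^ 2 * t)) ≤ 1 := Real.exp_le_one_iff.2 (neg_nonpos.2 (by positivity))
    rw [hmdef]
    nlinarith
  have hall : ∀ s ∈ Ico 0 t, m ≤ (g s).im := by
    by_contra! hlow
    obtain ⟨s, hs, hsm⟩ := hlow
    set S := Icc 0 s ∩ (fun u => (g u).im) ⁻¹' (Iic m) with hS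
    have hsub : Icc 0 s ⊆ Icc 0 t := Icc_subset_Icc_right hs.2.le
    have hcpt : IsCompact S :=
      isCompact_Icc.of_isClosed_subset
        ((hic.mono hsub).preimage_isClosed_of_isClosed isClosed_Icc isClosed_Iic) inter_subset_left
    obtain ⟨u, ⟨huI, hum⟩, humin⟩ := hcpt.exists_isLeast ⟨s, right_mem_Icc.2 hs.1, hsm.le⟩
    have habove : ∀ v ∈ Ico 0 u, m < (g v).im := fun v hv => by
      by_contra! h
      exact (humin ⟨⟨hv.1, hv.2.le.trans huI.2⟩, h⟩).not_gt hv.2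
    have hu0 : 0 < u := by
      rcases huI.1.eq_or_lt with h | h
      · rw [← h] at hum
        simp only [mem_preimage, hg0, mem_Iic] at hum
        linarith
      · exact h
    have hut : u ∈ Ico 0 t := ⟨huI.1, huI.2.trans_lt hs.2⟩
    have hu_ge : m ≤ (g u).im := by
      have hcl : u ∈ closure (Ico 0 u) := by
        rw [closure_Ico hu0.ne]
        exact right_mem_Icc.2 hu0.le
      have hcw : ContinuousWithinAt (fun u => (g u).im) (Ico 0 u) u :=
        (hic u (Ico_subset_Icc_self hut)).mono fun v hv => ⟨hv.1, hv.2.le.trans hut.2.le⟩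
      exact isClosed_Ici.closure_subset (hcw.mem_closure hcl fun v hv => (habove v hv).le)
    have := hfar u hut g (htraj u (Ico_subset_Icc_self hut) fun v hv =>
      hv.2.eq_or_lt.elim (fun h => h ▸ hu_ge) fun h => (habove v ⟨hv.1, h⟩).le)
    simp only [mem_preimage, mem_Iic] at hum
    linarith
  refine hno ⟨g, htraj t (right_mem_Icc.2 ht) fun u hu => ?_⟩
  rcases hu.2.eq_or_lt with h | h
  · subst h
    rcases ht.eq_or_lt with h0 | h0
    · rw [← h0, hg0]
      linarith
    · have hcl : u ∈ closure (Ico 0 u) := by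
        rw [closure_Ico h0.ne]
        exact right_mem_Icc.2 h0.le
      exact isClosed_Ici.closure_subset
        (((hic u (right_mem_Icc.2 ht)).mono Ico_subset_Icc_self).mem_closure hcl hall)
  · exact hall u ⟨hu.1, h⟩

/-! ### Comparison with the self-similar solution -/

/-- The positive root of `a ^ 2 - c * a - 4`. -/
noncomputable def growthConst (c : ℝ) : ℝ := (c + √(c ^ 2 + 16)) / 2

theorem growthConst_mul (c : ℝ) : growthConst c * (growthConst c - c) = 4 := by
  have := Real.sq_sqrt (show 0 ≤ c ^ 2 + 16 by positivity)
  rw [growthConst]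
  linear_combination this / 4

theorem abs_lt_sqrt_sq_add (c : ℝ) : |c| < √(c ^ 2 + 16) := by
  rw [← Real.sqrt_sq_eq_abs]
  exact Real.sqrt_lt_sqrt (sq_nonneg c) (by linarith)

theorem lt_growthConst (c : ℝ) : c < growthConst c := by
  have := (le_abs_self c).trans_lt (abs_lt_sqrt_sq_add c)
  rw [growthConst]
  linarith

theorem growthConst_pos (c : ℝ) : 0 < growthConst c := by
  have := (neg_le_abs c).trans_lt (abs_lt_sqrt_sq_add c)
  rw [growthConst]
  linarith

/-- The relation a(a - c) = 4 says a/2 = 2/(a - c), so the self-similar function a√u solves the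
equation driven by c√u. -/
theorem hasDerivAt_growthConst_mul_sqrt (c : ℝ) {u : ℝ} (hu : 0 < u) :
    HasDerivAt (fun u => growthConst c * √u) (2 / ((growthConst c - c) * √u)) u := by
  refine ((Real.hasDerivAt_sqrt hu.ne').const_mul (growthConst c)).congr_deriv ?_
  have h1 := growthConst_mul c
  have h2 : 0 < growthConst c - c := sub_pos.2 (lt_growthConst c)
  have h3 := Real.sqrt_pos.2 hu
  field_simp
  linarith

/-- Where y touches the barrier, y - λ ≥ (a - c)√u + ε, so y' is strictly below the slope of the
barrier; ε supplies the strictness. Being below at any one time s is enough. -/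
theorem sqrt_comparison {lam y y' : ℝ → ℝ} {l c s t ε : ℝ} (hε : 0 < ε)
    (hlam : ∀ u ∈ Ioo 0 t, lam u ≤ l + c * √u) (hy : ContinuousOn y (Icc 0 t))
    (hy' : ∀ u ∈ Ioo 0 t, HasDerivWithinAt y (y' u) (Ici u) u)
    (hle : ∀ u ∈ Ioo 0 t, lam u < y u → y' u ≤ 2 / (y u - lam u))
    (hs : s ∈ Icc 0 t) (h0 : y s < l + growthConst c * √s + ε) :
    y t ≤ l + growthConst c * √t + ε := by
  have hB : Continuous fun u : ℝ => l + growthConst c * √u + ε := by fun_prop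
  rcases hs.2.eq_or_lt with hst | hst
  · exact hst ▸ h0.le
  obtain ⟨r, hr, hyr⟩ : ∃ r ∈ Ioo 0 t, y r < l + growthConst c * √r + ε := by
    have hev : ∀ᶠ u in 𝓝[Icc 0 t] s, y u < l + growthConst c * √u + ε :=
      (hy s hs).eventually_lt hB.continuousWithinAt h0
    have hsub : 𝓝[>] s ≤ 𝓝[Icc 0 t] s := by
      rw [nhdsWithin_le_iff]
      exact mem_of_superset (Ioo_mem_nhdsGT hst) fun u hu => ⟨hs.1.trans hu.1.le, hu.2.le⟩
    obtain ⟨r, hr1, hr2⟩ := ((hev.filter_mono hsub).and (Ioo_mem_nhdsGT hst)).exists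
    exact ⟨r, ⟨hs.1.trans_lt hr2.1, hr2.2⟩, hr1⟩
  have hIco : ∀ u ∈ Ico r t, u ∈ Ioo 0 t := fun u hu => ⟨hr.1.trans_le hu.1, hu.2⟩
  refine image_le_of_deriv_right_lt_deriv_boundary'
    (hy.mono (Icc_subset_Icc_left hr.1.le)) (fun u hu => hy' u (hIco u hu)) hyr.le
    hB.continuousOn (B' := fun u => 2 / ((growthConst c - c) * √u)) (fun u hu => ?_)
    (fun u hu hyu => ?_) (right_mem_Icc.2 hr.2.le)
  · exact (((hasDerivAt_growthConst_mul_sqrt c (hIco u hu).1).const_add l).add_const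
      ε).hasDerivWithinAt
  · have hu0 := Real.sqrt_pos.2 (hIco u hu).1
    have h1 : 0 < (growthConst c - c) * √u := mul_pos (sub_pos.2 (lt_growthConst c)) hu0
    have h2 := hlam u (hIco u hu)
    have h3 : (growthConst c - c) * √u < y u - lam u := by
      rw [hyu]
      linarith
    exact (hle u (hIco u hu) (by linarith)).trans_lt (by gcongr)

theorem two_div_sq_mul_le {n x : ℝ} (hx : 0 < x) (hn : |x| ≤ n) : 2 / n ^ 2 * x ≤ 2 / x := by
  rw [abs_of_pos hx] at hn
  have hn0 := hx.trans_le hn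
  rw [div_mul_eq_mul_div, div_le_div_iff₀ (by positivity) hx]
  nlinarith

theorem abs_re_sub_le_norm (w : ℂ) (l : ℝ) : |w.re - l| ≤ ‖w - (l : ℂ)‖ := by
  simpa using Complex.abs_re_le_norm (w - (l : ℂ))

namespace IsLoewnerTrajectory

variable {lam : ℝ → ℝ} {z : ℂ} {s t l c ε : ℝ} {g : ℝ → ℂ}

theorem re_le (hg : IsLoewnerTrajectory lam z t g) (hε : 0 < ε)
    (hlam : ∀ u ∈ Icc 0 t, |lam u - l| ≤ c * √u) (hs : s ∈ Icc 0 t)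
    (h0 : (g s).re < l + growthConst c * √s + ε) : (g t).re ≤ l + growthConst c * √t + ε := by
  refine sqrt_comparison (lam := lam) (c := c) (y := fun u => (g u).re) hε
    (fun u hu => by linarith [le_abs_self (lam u - l), hlam u (Ioo_subset_Icc_self hu)])
    (Complex.continuous_re.comp_continuousOn hg.continuousOn)
    (fun u hu => ((hg.deriv u (Ioo_subset_Icc_self hu)).Ici_of_Icc
      (Ioo_subset_Ico_self hu)).complex_re) (fun u _ hlt => ?_) hs h0
  rw [loewner_rhs_re]
  exact two_div_sq_mul_le (sub_pos.2 hlt) (abs_re_sub_le_norm _ _)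

/-- The mirror image of `re_le` under reflection in the imaginary axis. -/
theorem le_re (hg : IsLoewnerTrajectory lam z t g) (hε : 0 < ε)
    (hlam : ∀ u ∈ Icc 0 t, |lam u - l| ≤ c * √u) (hs : s ∈ Icc 0 t)
    (h0 : l - growthConst c * √s - ε < (g s).re) : l - growthConst c * √t - ε ≤ (g t).re := by
  have := sqrt_comparison (lam := fun u => -lam u) (y := fun u => -(g u).re) (l := -l) (c := c) hε
    (fun u hu => by linarith [neg_abs_le (lam u - l), hlam u (Ioo_subset_Icc_self hu)])
    (Complex.continuous_re.comp_continuousOn hg.continuousOn).neg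
    (fun u hu => ((hg.deriv u (Ioo_subset_Icc_self hu)).Ici_of_Icc
      (Ioo_subset_Ico_self hu)).complex_re.neg) (fun u _ hlt => ?_) hs (by linarith)
  · linarith
  rw [loewner_rhs_re, ← mul_neg, neg_sub, neg_sub_neg]
  refine two_div_sq_mul_le (by linarith) ?_
  rw [abs_sub_comm]
  exact abs_re_sub_le_norm _ _

end IsLoewnerTrajectory

/-! ### The slit image and its right endpoint -/

theorem Icc_subset_timeInterval {T : ℝ≥0∞} {t : ℝ} (ht : t ∈ timeInterval T) :
    Icc 0 t ⊆ timeInterval T := fun _ hu =>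
  ⟨hu.1, (ENNReal.ofReal_le_ofReal hu.2).trans_lt ht.2⟩

theorem zero_mem_timeInterval {T : ℝ≥0∞} (hT : 0 < T) : (0 : ℝ) ∈ timeInterval T :=
  ⟨le_rfl, by simpa using hT⟩

theorem eventually_mem_timeInterval {T : ℝ≥0∞} (hT : 0 < T) :
    ∀ᶠ t in 𝓝[>] (0 : ℝ), t ∈ timeInterval T := by
  have h : ∀ᶠ t in 𝓝 (0 : ℝ), ENNReal.ofReal t < T :=
    ENNReal.continuous_ofReal.continuousAt.eventually_lt continuousAt_const (by simpa using hT)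
  filter_upwards [nhdsWithin_le_nhds h, self_mem_nhdsWithin] with t h1 h2
  exact ⟨le_of_lt h2, h1⟩

theorem HasLipHalfNorm.abs_sub_le {lam : ℝ → ℝ} {T : ℝ≥0∞} {c : ℝ≥0}
    (h : HasLipHalfNorm lam T c) {s t : ℝ} (hs : s ∈ timeInterval T) (ht : t ∈ timeInterval T) :
    |lam t - lam s| ≤ c * √|t - s| := by
  have h1 := h.1.holderWith
  rw [h.2] at h1
  have h2 := h1.dist_le ⟨t, ht⟩ ⟨s, hs⟩
  rw [Subtype.dist_eq, Real.dist_eq, Real.dist_eq] at h2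
  rw [Real.sqrt_eq_rpow]
  simpa using h2

theorem HasLipHalfNorm.continuousOn {lam : ℝ → ℝ} {T : ℝ≥0∞} {c : ℝ≥0}
    (h : HasLipHalfNorm lam T c) : ContinuousOn lam (timeInterval T) := by
  rw [continuousOn_iff_continuous_domRestrict]
  obtain ⟨C, hC⟩ := h.1
  exact hC.continuous (by norm_num)

theorem loewnerMap_mem {lam : ℝ → ℝ} {t : ℝ} {z : ℂ} (ht : 0 ≤ t)
    (hlam : ContinuousOn lam (Icc 0 t)) (hz : z ∈ loewnerDomain lam t) :
    ∃ g, IsLoewnerTrajectory lam z t g ∧ loewnerMap lam t z = g t := by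
  obtain ⟨hz0, g, hg⟩ := hz
  exact ⟨g, hg, hg.loewnerMap_eq hlam hz0 ht⟩

namespace GeneratesQuasislits

variable {lam : ℝ → ℝ} {T : ℝ≥0∞} {γ : ℝ → ℂ} {c t : ℝ}

/-- Near a slit point, trajectories pass below the barrier at some time: at time 0 for the root,
otherwise at a time r when the dying trajectory of γ(s) is within ε/2 of λ(r) and its neighbours are
within ε/2 of it. -/
theorem eventually_re_loewnerMap_le (hγ : GeneratesQuasislits lam T γ)
    (hcont : ContinuousOn lam (timeInterval T))
    (hlam : ∀ u ∈ timeInterval T, |lam u - lam 0| ≤ c * √u) (ht : t ∈ timeInterval T)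
    {p : ℂ} (hp : p ∈ γ '' Icc 0 t) {ε : ℝ} (hε : 0 < ε) :
    ∀ᶠ z in 𝓝[loewnerDomain lam t] p,
      (loewnerMap lam t z).re ≤ lam 0 + growthConst c * √t + ε := by
  have hsub := Icc_subset_timeInterval ht
  obtain ⟨s, hs, rfl⟩ := hp
  have hs' := hsub hs
  rcases hs.1.eq_or_lt with h0 | h0
  · filter_upwards [self_mem_nhdsWithin, nhdsWithin_le_nhds (Metric.ball_mem_nhds (γ s) hε)]
      with z hz hzb
    obtain ⟨g, hg, hgz⟩ := loewnerMap_mem ht.1 (hcont.mono hsub) hz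
    rw [hgz]
    refine hg.re_le hε (fun u hu => hlam u (hsub hu)) (left_mem_Icc.2 ht.1) ?_
    rw [← h0, hγ.root, mem_ball_iff_norm] at hzb
    have := (le_abs_self _).trans_lt ((abs_re_sub_le_norm z (lam 0)).trans_lt hzb)
    rw [hg.init, Real.sqrt_zero]
    linarith
  · have hpos := hγ.im_pos s hs' h0
    have hsub' := Icc_subset_timeInterval hs'
    have hno : ¬ ∃ g, IsLoewnerTrajectory lam (γ s) s g := fun hex => by
      have hmem : γ s ∈ loewnerDomain lam s := ⟨hpos, hex⟩
      rw [hγ.domain_eq s hs'] at hmem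
      exact hmem.2 ⟨s, right_mem_Icc.2 hs.1, rfl⟩
    obtain ⟨r, hr, k, hk, hkr⟩ := exists_trajectory_near_driving (hcont.mono hsub') hs.1 hpos hno
      (half_pos hε)
    have hrt : r ≤ t := hr.2.le.trans hs.2
    have hr' : r ∈ timeInterval T := hsub ⟨hr.1, hrt⟩
    obtain ⟨δ, hδ, hdep⟩ := hk.exists_forall_dist_lt
      (hcont.mono (Icc_subset_timeInterval hr')) hpos hr.1 (half_pos hε)
    filter_upwards [self_mem_nhdsWithin, nhdsWithin_le_nhds (Metric.ball_mem_nhds (γ s) hδ)]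
      with z hz hzb
    obtain ⟨g, hg, hgz⟩ := loewnerMap_mem ht.1 (hcont.mono hsub) hz
    rw [hgz]
    refine hg.re_le hε (fun u hu => hlam u (hsub hu)) ⟨hr.1, hrt⟩ ?_
    have h1 := hdep z g hz.1 hzb (hg.restrict hrt)
    rw [dist_eq_norm] at h1
    have h2 := (le_abs_self _).trans_lt ((Complex.abs_re_le_norm _).trans_lt h1)
    have h3 := (le_abs_self _).trans_lt ((abs_re_sub_le_norm _ _).trans_lt hkr)
    have h4 := (le_abs_self _).trans (hlam r hr')
    have h5 : c * √r ≤ growthConst c * √r := by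
      have := (lt_growthConst c).le
      gcongr
    rw [Complex.sub_re] at h2
    linarith

theorem le_of_mem_slitImage (hγ : GeneratesQuasislits lam T γ)
    (hcont : ContinuousOn lam (timeInterval T))
    (hlam : ∀ u ∈ timeInterval T, |lam u - lam 0| ≤ c * √u) (ht : t ∈ timeInterval T)
    {x : ℝ} (hx : x ∈ slitImage lam γ t) : x ≤ lam 0 + growthConst c * √t := by
  obtain ⟨p, hp, hx⟩ := hx
  refine le_of_forall_pos_le_add fun ε hε => ?_
  have hcl : IsClosed {w : ℂ | w.re ≤ lam 0 + growthConst c * √t + ε} :=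
    isClosed_le Complex.continuous_re continuous_const
  simpa using hcl.mem_of_mapClusterPt hx
    (hγ.eventually_re_loewnerMap_le hcont hlam ht hp hε)

theorem neBot_nhdsWithin_root (hγ : GeneratesQuasislits lam T γ) (ht : t ∈ timeInterval T) :
    (𝓝[loewnerDomain lam t] (lam 0 : ℂ)).NeBot := by
  obtain ⟨M, hM⟩ : ∃ M : ℝ, ∀ z ∈ γ '' Icc 0 t, |z.re - lam 0| ≤ M * z.im := by
    rcases ht.1.eq_or_lt with h | h
    · refine ⟨0, ?_⟩
      rw [← h]
      simp [hγ.root]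
    · exact (hγ.quasislit t ht h).2.2
  rw [hγ.domain_eq t ht]
  -- The direction (|M| + 1) + i lies outside the Stolz angle, so this segment approaches the root
  -- without meeting the slit.
  have hlim : Tendsto (fun η : ℝ => (lam 0 : ℂ) + η * ⟨|M| + 1, 1⟩) (𝓝[>] 0) (𝓝 (lam 0 : ℂ)) := by
    refine Tendsto.mono_left ?_ nhdsWithin_le_nhds
    have : Continuous fun η : ℝ => (lam 0 : ℂ) + η * ⟨|M| + 1, 1⟩ := by fun_prop
    simpa using this.tendsto 0
  refine (tendsto_nhdsWithin_iff.2 ⟨hlim, ?_⟩).neBot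
  filter_upwards [self_mem_nhdsWithin] with η hη
  have hη0 : 0 < η := hη
  refine ⟨by simpa using hη0, fun hmem => ?_⟩
  have h1 := hM _ hmem
  simp only [Complex.add_re, Complex.ofReal_re, Complex.mul_re, Complex.ofReal_im, zero_mul,
    sub_zero, add_sub_cancel_left, Complex.add_im, Complex.mul_im, mul_one, zero_add,
    add_zero] at h1
  rw [abs_of_pos (by positivity)] at h1
  nlinarith [le_abs_self M]

/-- Needed because the supremum of an empty set of reals is 0. Near the root the two barriers bound
the real part, and the imaginary part is squeezed to 0 by Im z, so compactness yields a real limit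
value. -/
theorem slitImage_nonempty (hγ : GeneratesQuasislits lam T γ)
    (hcont : ContinuousOn lam (timeInterval T))
    (hlam : ∀ u ∈ timeInterval T, |lam u - lam 0| ≤ c * √u) (ht : t ∈ timeInterval T) :
    (slitImage lam γ t).Nonempty := by
  have hsub := Icc_subset_timeInterval ht
  have hne := hγ.neBot_nhdsWithin_root ht
  set F := 𝓝[loewnerDomain lam t] (lam 0 : ℂ) with hF
  have him : ∀ᶠ z in F, (loewnerMap lam t z).im ∈ Icc 0 z.im := by
    filter_upwards [self_mem_nhdsWithin] with z hz
    obtain ⟨g, hg, hgz⟩ := loewnerMap_mem ht.1 (hcont.mono hsub) hz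
    have h1 := hg.im_antitone (hcont.mono hsub) hz.1 (left_mem_Icc.2 ht.1) (right_mem_Icc.2 ht.1)
      ht.1
    simp only [hg.init] at h1
    rw [hgz]
    exact ⟨(hg.im_pos (hcont.mono hsub) hz.1 (right_mem_Icc.2 ht.1)).le, h1⟩
  have hzim : Tendsto (fun z : ℂ => z.im) F (𝓝 0) := by
    have := (Complex.continuous_im.tendsto (lam 0 : ℂ)).mono_left
      (nhdsWithin_le_nhds (s := loewnerDomain lam t))
    simpa using this
  have himlim : Tendsto (fun z => (loewnerMap lam t z).im) F (𝓝 0) :=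
    tendsto_of_tendsto_of_tendsto_of_le_of_le' tendsto_const_nhds hzim
      (him.mono fun _ h => h.1) (him.mono fun _ h => h.2)
  set K := Icc (lam 0 - growthConst c * √t - 1) (lam 0 + growthConst c * √t + 1) ×ℂ Icc 0 1
    with hK
  have hmem : ∀ᶠ z in F, loewnerMap lam t z ∈ K := by
    filter_upwards [self_mem_nhdsWithin, nhdsWithin_le_nhds (Metric.ball_mem_nhds _ one_pos), him]
      with z hz hzb hzi
    obtain ⟨g, hg, hgz⟩ := loewnerMap_mem ht.1 (hcont.mono hsub) hz
    rw [mem_ball_iff_norm] at hzb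
    have hre := abs_lt.1 ((abs_re_sub_le_norm z (lam 0)).trans_lt hzb)
    have him1 := (im_le_norm_sub_ofReal z (lam 0)).trans hzb.le
    refine ⟨⟨?_, ?_⟩, hzi.1, hzi.2.trans him1⟩
    · rw [hgz]
      refine hg.le_re one_pos (fun u hu => hlam u (hsub hu)) (left_mem_Icc.2 ht.1) ?_
      rw [hg.init, Real.sqrt_zero]
      linarith
    · rw [hgz]
      refine hg.re_le one_pos (fun u hu => hlam u (hsub hu)) (left_mem_Icc.2 ht.1) ?_
      rw [hg.init, Real.sqrt_zero]
      linarith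
  obtain ⟨w, -, hw⟩ := (isCompact_Icc.reProdIm isCompact_Icc).exists_mapClusterPt
    (f := F) (u := loewnerMap lam t) (tendsto_principal.2 hmem)
  have hw0 : w.im = 0 := by
    have h1 := hw.continuousAt_comp Complex.continuous_im.continuousAt
    have : (𝓝 w.im ⊓ 𝓝 0).NeBot := h1.clusterPt.neBot.mono (inf_le_inf_left _ himlim)
    exact eq_of_nhds_neBot this
  refine ⟨w.re, γ 0, ⟨0, left_mem_Icc.2 ht.1, rfl⟩, ?_⟩
  rw [hγ.root, ← Complex.ext (z := w) (w := (w.re : ℂ)) rfl (by simpa using hw0)]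
  exact hw

theorem rightEndpoint_le (hγ : GeneratesQuasislits lam T γ)
    (hcont : ContinuousOn lam (timeInterval T))
    (hlam : ∀ u ∈ timeInterval T, |lam u - lam 0| ≤ c * √u) (ht : t ∈ timeInterval T) :
    rightEndpoint lam γ t ≤ lam 0 + growthConst c * √t :=
  csSup_le (hγ.slitImage_nonempty hcont hlam ht) fun _ hx =>
    hγ.le_of_mem_slitImage hcont hlam ht hx

theorem rightEndpoint_zero (hγ : GeneratesQuasislits lam T γ) (hT : 0 < T)
    (hcont : ContinuousOn lam (timeInterval T))
    (hlam : ∀ u ∈ timeInterval T, |lam u - lam 0| ≤ c * √u) :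
    rightEndpoint lam γ 0 = lam 0 := by
  have h0 := zero_mem_timeInterval hT
  have hle : ∀ x ∈ slitImage lam γ 0, x ≤ lam 0 := fun x hx => by
    simpa using hγ.le_of_mem_slitImage hcont hlam h0 hx
  refine (csSup_le (hγ.slitImage_nonempty hcont hlam h0) hle).antisymm
    (le_csSup ⟨_, hle⟩ ⟨γ 0, ⟨0, by simp, rfl⟩, ?_⟩)
  rw [hγ.root]
  have hne := hγ.neBot_nhdsWithin_root h0
  refine Tendsto.mapClusterPt ((tendsto_id.mono_left nhdsWithin_le_nhds).congr' ?_)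
  filter_upwards [self_mem_nhdsWithin] with z hz
  obtain ⟨g, hg, hgz⟩ := loewnerMap_mem le_rfl (hcont.mono (Icc_subset_timeInterval h0)) hz
  rw [hgz, hg.init, id]

end GeneratesQuasislits

theorem IsRightSingularSolution.le {lam x : ℝ → ℝ} {T : ℝ≥0∞} {c t : ℝ}
    (hx : IsRightSingularSolution lam T x)
    (hlam : ∀ u ∈ timeInterval T, |lam u - lam 0| ≤ c * √u) (ht : t ∈ timeInterval T) :
    x t ≤ lam 0 + growthConst c * √t := by
  have hsub := Icc_subset_timeInterval ht
  refine le_of_forall_pos_le_add fun ε hε => ?_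
  refine sqrt_comparison hε
    (fun u hu => by linarith [le_abs_self (lam u - lam 0), hlam u (hsub (Ioo_subset_Icc_self hu))])
    (hx.continuousOn.mono hsub)
    (fun u hu => (hx.deriv u (hsub (Ioo_subset_Icc_self hu)) hu.1).hasDerivWithinAt)
    (fun u _ _ => le_rfl) (left_mem_Icc.2 ht.1) ?_
  rw [hx.init, Real.sqrt_zero]
  linarith

theorem sqrtGrowth_le {x : ℝ → ℝ} {a : ℝ}
    (h : ∀ᶠ t in 𝓝[>] 0, x t ≤ x 0 + a * √t) : sqrtGrowth x ≤ (a : EReal) := by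
  refine limsup_le_of_le (by isBoundedDefault) ?_
  filter_upwards [h, self_mem_nhdsWithin] with t ht h0
  rw [EReal.coe_le_coe_iff, div_le_iff₀ (Real.sqrt_pos.2 h0)]
  linarith

/-! ### The driving term `c * √t` -/

/-- The derivative is required only in the interior, since √u is not differentiable at 0. -/
theorem eq_of_hasDerivWithinAt_zero {f : ℝ → ℝ} {t : ℝ} (ht : 0 ≤ t)
    (hc : ContinuousOn f (Icc 0 t)) (h : ∀ u ∈ Ioo 0 t, HasDerivWithinAt f 0 (Ioo 0 t) u) :
    f t = f 0 := by
  have h0 := left_mem_Icc.2 ht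
  have h1 := right_mem_Icc.2 ht
  rw [← interior_Icc] at h
  exact (antitoneOn_of_hasDerivWithinAt_nonpos (convex_Icc 0 t) hc h (fun _ _ => le_rfl)
    h0 h1 ht).antisymm (monotoneOn_of_hasDerivWithinAt_nonneg (convex_Icc 0 t) hc h
      (fun _ _ => le_rfl) h0 h1 ht)

/-! ### The conserved quantity -/

/-- The weight of `log (w - a * √t)` in the conserved quantity; here `a = growthConst c`. -/
noncomputable def rightWeight (c : ℝ) : ℝ := (growthConst c - c) / (2 * growthConst c - c)

/-- The weight of `log (w - (c - a) * √t)` in the conserved quantity. -/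
noncomputable def leftWeight (c : ℝ) : ℝ := growthConst c / (2 * growthConst c - c)

theorem two_mul_growthConst_sub_pos (c : ℝ) : 0 < 2 * growthConst c - c := by
  linarith [growthConst_pos c, lt_growthConst c]

theorem rightWeight_pos (c : ℝ) : 0 < rightWeight c :=
  div_pos (sub_pos.2 (lt_growthConst c)) (two_mul_growthConst_sub_pos c)

theorem leftWeight_pos (c : ℝ) : 0 < leftWeight c :=
  div_pos (growthConst_pos c) (two_mul_growthConst_sub_pos c)

theorem rightWeight_add_leftWeight (c : ℝ) : rightWeight c + leftWeight c = 1 := by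
  have := (two_mul_growthConst_sub_pos c).ne'
  rw [rightWeight, leftWeight, ← add_div, div_eq_one_iff_eq this]
  ring

/-- The quantity conserved by the Löwner flow driven by `c * √t`. -/
noncomputable def flowInvariant (c t : ℝ) (w : ℂ) : ℂ :=
  rightWeight c * Complex.log (w - (growthConst c * √t : ℝ)) +
    leftWeight c * Complex.log (w + ((growthConst c - c) * √t : ℝ))

theorem flowInvariant_zero (c : ℝ) (w : ℂ) : flowInvariant c 0 w = Complex.log w := by
  have : (rightWeight c : ℂ) + leftWeight c = 1 := mod_cast rightWeight_add_leftWeight c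
  simp [flowInvariant, ← add_mul, this]

theorem mem_slitPlane_of_im_pos {w : ℂ} (hw : 0 < w.im) : w ∈ Complex.slitPlane :=
  Complex.mem_slitPlane_iff.2 (Or.inr hw.ne')

theorem continuous_mul_sqrt (c : ℝ) : Continuous fun u : ℝ => c * √u := by fun_prop

/-- By a(a - c) = 4 the numerators are multiples of the denominators: the two quotients are -a and a
- c, each divided by 2r(g - cr). The weights, in ratio a - c to a, make them cancel. -/
theorem flowInvariant_deriv_eq_zero {c r : ℝ} {g : ℂ} (hr : 0 < r) (hg : 0 < g.im) :
    (rightWeight c : ℂ) * ((2 / (g - (c * r : ℝ)) - (growthConst c * (1 / (2 * r)) : ℝ)) /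
        (g - (growthConst c * r : ℝ))) +
      leftWeight c * ((2 / (g - (c * r : ℝ)) + ((growthConst c - c) * (1 / (2 * r)) : ℝ)) /
        (g + ((growthConst c - c) * r : ℝ))) = 0 := by
  have hne : ∀ x : ℝ, g - (x : ℂ) ≠ 0 := fun x h => by
    have := congrArg Complex.im h
    simp only [Complex.sub_im, Complex.ofReal_im, sub_zero, Complex.zero_im] at this
    exact hg.ne' this
  have h1 := hne (c * r)
  have h2 := hne (growthConst c * r)
  have h3 : g + ((growthConst c - c) * r : ℝ) ≠ 0 := by
    simpa using hne (-((growthConst c - c) * r))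
  have h4 : (r : ℂ) ≠ 0 := mod_cast hr.ne'
  have h5 : (2 * growthConst c - c : ℂ) ≠ 0 := mod_cast (two_mul_growthConst_sub_pos c).ne'
  have h6 : (growthConst c : ℂ) * (growthConst c - c) = 4 := mod_cast growthConst_mul c
  rw [rightWeight, leftWeight]
  push_cast at *
  generalize (growthConst c : ℂ) = a at *
  field_simp
  rw [mul_zero, div_eq_zero_iff]
  left
  linear_combination (-(r * (g - c * r) * (2 * a - c))) * h6

theorem IsLoewnerTrajectory.flowInvariant_eq {c t : ℝ} {z : ℂ} {g : ℝ → ℂ}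
    (hg : IsLoewnerTrajectory (fun t => c * √t) z t g) (ht : 0 ≤ t) (hz : 0 < z.im) :
    flowInvariant c t (g t) = Complex.log z := by
  have him : ∀ u ∈ Icc 0 t, 0 < (g u).im := fun u hu =>
    hg.im_pos (continuous_mul_sqrt c).continuousOn hz hu
  have hsp : ∀ u ∈ Icc 0 t, ∀ x : ℝ, g u - (x : ℂ) ∈ Complex.slitPlane := fun u hu x =>
    mem_slitPlane_of_im_pos (by simpa using him u hu)
  have hsp' : ∀ u ∈ Icc 0 t, ∀ x : ℝ, g u + (x : ℂ) ∈ Complex.slitPlane := fun u hu x =>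
    mem_slitPlane_of_im_pos (by simpa using him u hu)
  have hcs : ∀ a : ℝ, ContinuousOn (fun u : ℝ => ((a * √u : ℝ) : ℂ)) (Icc 0 t) := fun a =>
    (Complex.continuous_ofReal.comp (continuous_mul_sqrt a)).continuousOn
  have hcont : ContinuousOn (fun u => flowInvariant c u (g u)) (Icc 0 t) :=
    (continuousOn_const.mul ((hg.continuousOn.sub (hcs _)).clog fun u hu => hsp u hu _)).add
      (continuousOn_const.mul ((hg.continuousOn.add (hcs _)).clog fun u hu => hsp' u hu _))
  have hder : ∀ u ∈ Ioo 0 t, HasDerivWithinAt (fun u => flowInvariant c u (g u)) 0 (Ioo 0 t) u := by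
    intro u hu
    have huI := Ioo_subset_Icc_self hu
    have hs : ∀ a : ℝ, HasDerivWithinAt (fun u : ℝ => ((a * √u : ℝ) : ℂ))
        ((a * (1 / (2 * √u)) : ℝ) : ℂ) (Ioo 0 t) u := fun a =>
      ((Real.hasDerivAt_sqrt hu.1.ne').const_mul a).ofReal_comp.hasDerivWithinAt
    have hgd := (hg.deriv u huI).mono Ioo_subset_Icc_self
    have h1 := ((hgd.sub (hs (growthConst c))).clog_real (hsp u huI _)).const_mul
      (rightWeight c : ℂ)
    have h2 := ((hgd.add (hs (growthConst c - c))).clog_real (hsp' u huI _)).const_mul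
      (leftWeight c : ℂ)
    exact (h1.add h2).congr_deriv
      (flowInvariant_deriv_eq_zero (Real.sqrt_pos.2 hu.1) (him u huI))
  have h0 : flowInvariant c t (g t) = flowInvariant c 0 (g 0) :=
    Complex.ext
      (eq_of_hasDerivWithinAt_zero ht (Complex.continuous_re.comp_continuousOn hcont)
        fun u hu => (hder u hu).complex_re)
      (eq_of_hasDerivWithinAt_zero ht (Complex.continuous_im.comp_continuousOn hcont)
        fun u hu => (hder u hu).complex_im)
  rw [h0, flowInvariant_zero, hg.init]

theorem IsLoewnerTrajectory.norm_eq {c t : ℝ} {z : ℂ} {g : ℝ → ℂ}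
    (hg : IsLoewnerTrajectory (fun t => c * √t) z t g) (ht : 0 ≤ t) (hz : 0 < z.im) :
    ‖z‖ = ‖g t - (growthConst c * √t : ℝ)‖ ^ rightWeight c *
      ‖g t + ((growthConst c - c) * √t : ℝ)‖ ^ leftWeight c := by
  have hpos := hg.im_pos (continuous_mul_sqrt c).continuousOn hz (right_mem_Icc.2 ht)
  have h := congrArg Complex.re (hg.flowInvariant_eq ht hz)
  have hn : ∀ x : ℂ, 0 < x.im → 0 < ‖x‖ := fun x hx =>
    norm_pos_iff.2 fun h => by simp [h] at hx
  have h1 := hn (g t - (growthConst c * √t : ℝ)) (by simpa using hpos)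
  have h2 := hn (g t + ((growthConst c - c) * √t : ℝ)) (by simpa using hpos)
  rw [flowInvariant, Complex.add_re, Complex.re_ofReal_mul, Complex.re_ofReal_mul,
    Complex.log_re, Complex.log_re, Complex.log_re] at h
  rw [Real.rpow_def_of_pos h1, Real.rpow_def_of_pos h2, ← Real.exp_add,
    ← Real.exp_log (hn z hz), ← h]
  ring_nf

theorem IsLoewnerTrajectory.arg_eq {c t : ℝ} {z : ℂ} {g : ℝ → ℂ}
    (hg : IsLoewnerTrajectory (fun t => c * √t) z t g) (ht : 0 ≤ t) (hz : 0 < z.im) :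
    z.arg = rightWeight c * (g t - (growthConst c * √t : ℝ)).arg +
      leftWeight c * (g t + ((growthConst c - c) * √t : ℝ)).arg := by
  have h := congrArg Complex.im (hg.flowInvariant_eq ht hz)
  rw [flowInvariant, Complex.add_im, Complex.im_ofReal_mul, Complex.im_ofReal_mul,
    Complex.log_im, Complex.log_im, Complex.log_im] at h
  exact h.symm

/-! ### The ray of absorbed points -/

/-- The modulus of the point of the half-plane absorbed at time `1`. -/
noncomputable def tipModulus (c : ℝ) : ℝ :=
  (growthConst c - c) ^ rightWeight c * growthConst c ^ leftWeight c

/-- The point of the half-plane absorbed at time `1` by the flow driven by `c * √t`. -/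
noncomputable def slitTip (c : ℝ) : ℂ :=
  tipModulus c * (Real.cos (Real.pi * rightWeight c) + Real.sin (Real.pi * rightWeight c) *
    Complex.I)

theorem tipModulus_pos (c : ℝ) : 0 < tipModulus c :=
  mul_pos (Real.rpow_pos_of_pos (sub_pos.2 (lt_growthConst c)) _)
    (Real.rpow_pos_of_pos (growthConst_pos c) _)

theorem pi_mul_rightWeight_mem (c : ℝ) : Real.pi * rightWeight c ∈ Ioo 0 Real.pi := by
  have h1 := rightWeight_pos c
  have h2 : rightWeight c < 1 := by linarith [leftWeight_pos c, rightWeight_add_leftWeight c]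
  exact ⟨by positivity, by nlinarith [Real.pi_pos]⟩

theorem slitTip_im_pos (c : ℝ) : 0 < (slitTip c).im := by
  have h := Real.sin_pos_of_mem_Ioo (pi_mul_rightWeight_mem c)
  have := tipModulus_pos c
  rw [slitTip, Complex.im_ofReal_mul]
  simp only [Complex.add_im, Complex.ofReal_im, Complex.mul_im, Complex.ofReal_re, Complex.I_im,
    Complex.I_re]
  simpa using mul_pos this h

theorem norm_slitTip (c : ℝ) : ‖slitTip c‖ = tipModulus c := by
  have : ‖(Real.cos (Real.pi * rightWeight c) : ℂ) + Real.sin (Real.pi * rightWeight c) *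
      Complex.I‖ = 1 := by
    rw [Complex.ofReal_cos, Complex.ofReal_sin]
    exact Complex.norm_cos_add_sin_mul_I _
  rw [slitTip, norm_mul, this, mul_one, Complex.norm_of_nonneg (tipModulus_pos c).le]

theorem arg_mul_slitTip (c : ℝ) {r : ℝ} (hr : 0 < r) :
    ((r : ℂ) * slitTip c).arg = Real.pi * rightWeight c := by
  have h := pi_mul_rightWeight_mem c
  rw [slitTip, ← mul_assoc, ← Complex.ofReal_mul, Complex.ofReal_cos, Complex.ofReal_sin]
  exact Complex.arg_mul_cos_add_sin_mul_I (mul_pos hr (tipModulus_pos c))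
    ⟨by linarith [h.1, Real.pi_pos], h.2.le⟩

theorem sqrt_mul_tipModulus (c s : ℝ) :
    √s * tipModulus c = ((growthConst c - c) * √s) ^ rightWeight c *
      (growthConst c * √s) ^ leftWeight c := by
  rw [Real.mul_rpow (sub_pos.2 (lt_growthConst c)).le (Real.sqrt_nonneg s),
    Real.mul_rpow (growthConst_pos c).le (Real.sqrt_nonneg s), tipModulus]
  rcases (Real.sqrt_nonneg s).eq_or_lt with h | h
  · rw [← h, Real.zero_rpow (rightWeight_pos c).ne', Real.zero_rpow (leftWeight_pos c).ne']
    simp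
  · have h1 : √s ^ rightWeight c * √s ^ leftWeight c = √s := by
      rw [← Real.rpow_add h, rightWeight_add_leftWeight, Real.rpow_one]
    linear_combination (-((growthConst c - c) ^ rightWeight c * growthConst c ^ leftWeight c)) * h1

theorem arg_mem_Ioo_of_im_pos {w : ℂ} (hw : 0 < w.im) : w.arg ∈ Ioo 0 Real.pi := by
  refine ⟨(Complex.arg_nonneg_iff.2 hw.le).lt_of_ne' fun h => ?_,
    Complex.arg_lt_pi_iff.2 (Or.inr hw.ne')⟩
  exact hw.ne' (Complex.arg_eq_zero_iff.1 h).2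

/-- The triangle with vertices -q, p, w has angles αφ, βφ, π - φ. The law of sines gives ‖w - p‖ =
(p + q) sin(αφ)/sin φ, and similarly for ‖w + q‖; strict concavity gives sin(αφ) > α sin φ. -/
theorem lt_norms_of_weighted_arg_eq {p q α β : ℝ} {w : ℂ} (hpq : 0 < p + q) (hα : 0 < α)
    (hβ : 0 < β) (hαβ : α + β = 1) (hw : 0 < w.im)
    (harg : α * (w - (p : ℂ)).arg + β * (w + (q : ℂ)).arg = Real.pi * α) :
    α * (p + q) < ‖w - (p : ℂ)‖ ∧ β * (p + q) < ‖w + (q : ℂ)‖ := by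
  have i1 : (w - (p : ℂ)).im = w.im := by simp
  have i2 : (w + (q : ℂ)).im = w.im := by simp
  have s1 := Complex.norm_mul_sin_arg (w - (p : ℂ))
  have c1 := Complex.norm_mul_cos_arg (w - (p : ℂ))
  have s2 := Complex.norm_mul_sin_arg (w + (q : ℂ))
  have c2 := Complex.norm_mul_cos_arg (w + (q : ℂ))
  have r1 : (w - (p : ℂ)).re = w.re - p := by simp
  have r2 : (w + (q : ℂ)).re = w.re + q := by simp
  have a1 : 0 < (w - (p : ℂ)).arg ∧ (w - (p : ℂ)).arg < Real.pi :=
    arg_mem_Ioo_of_im_pos (by rwa [i1])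
  have a2 : 0 < (w + (q : ℂ)).arg ∧ (w + (q : ℂ)).arg < Real.pi :=
    arg_mem_Ioo_of_im_pos (by rwa [i2])
  rw [i1] at s1
  rw [i2] at s2
  rw [r1] at c1
  rw [r2] at c2
  generalize (w - (p : ℂ)).arg = θ₁ at *
  generalize (w + (q : ℂ)).arg = θ₂ at *
  generalize ‖w - (p : ℂ)‖ = R₁ at *
  generalize ‖w + (q : ℂ)‖ = R₂ at *
  obtain ⟨φ, rfl⟩ : ∃ φ, θ₂ = α * φ := ⟨θ₂ / α, by field_simp⟩
  have hθ : θ₁ = Real.pi - β * φ := by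
    apply mul_left_cancel₀ hα.ne'
    linarith
  subst hθ
  have hφ : 0 < φ := pos_of_mul_pos_right a2.1 hα.le
  have hφ2 : φ < 2 * Real.pi := by
    have : φ = α * φ + β * φ := by rw [← add_mul, hαβ, one_mul]
    linarith
  rw [Real.sin_pi_sub] at s1
  rw [Real.cos_pi_sub] at c1
  have hsin : Real.sin φ = Real.sin (α * φ) * Real.cos (β * φ) +
      Real.cos (α * φ) * Real.sin (β * φ) := by
    rw [← Real.sin_add, ← add_mul, hαβ, one_mul]
  have sa : 0 < Real.sin (α * φ) := Real.sin_pos_of_mem_Ioo a2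
  have sb : 0 < Real.sin (β * φ) := Real.sin_pos_of_mem_Ioo ⟨by positivity, by linarith⟩
  have hR2 : 0 < R₂ := pos_of_mul_pos_left (by rw [s2]; exact hw) sa.le
  have e1 : (p + q) * Real.sin (α * φ) = R₁ * Real.sin φ := by
    rw [hsin]
    linear_combination (-Real.sin (α * φ)) * c2 + Real.sin (α * φ) * c1 +
      Real.cos (α * φ) * (s2 - s1)
  have e2 : (p + q) * Real.sin (β * φ) = R₂ * Real.sin φ := by
    rw [hsin]
    linear_combination (-Real.sin (β * φ)) * c2 + Real.sin (β * φ) * c1 +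
      Real.cos (β * φ) * (s1 - s2)
  have sφ : 0 < Real.sin φ := pos_of_mul_pos_right (by rw [← e2]; positivity) hR2.le
  have hφπ : φ < Real.pi := by
    by_contra! h
    have h1 : 0 ≤ Real.sin (φ - Real.pi) :=
      Real.sin_nonneg_of_nonneg_of_le_pi (by linarith) (by linarith)
    rw [Real.sin_sub_pi] at h1
    linarith
  have conc : ∀ x y : ℝ, 0 < x → 0 < y → x + y = 1 → x * Real.sin φ < Real.sin (x * φ) := by
    intro x y hx hy hxy
    simpa using strictConcaveOn_sin_Icc.2 ⟨hφ.le, hφπ.le⟩ ⟨le_rfl, Real.pi_pos.le⟩ hφ.ne' hx hy hxy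
  have k1 := conc α β hα hβ hαβ
  have k2 := conc β α hβ hα (by linarith)
  constructor
  · refine lt_of_mul_lt_mul_right ?_ sφ.le
    rw [← e1]
    nlinarith
  · refine lt_of_mul_lt_mul_right ?_ sφ.le
    rw [← e2]
    nlinarith

/-- The trace of the driving term `c * √t`, a straight ray. -/
noncomputable def slitRay (c t : ℝ) : ℂ := (√t : ℂ) * slitTip c

theorem slitRay_im (c t : ℝ) : (slitRay c t).im = √t * (slitTip c).im := by simp [slitRay]

theorem slitRay_re (c t : ℝ) : (slitRay c t).re = √t * (slitTip c).re := by simp [slitRay]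

theorem slitRay_im_pos (c : ℝ) {t : ℝ} (ht : 0 < t) : 0 < (slitRay c t).im := by
  rw [slitRay_im]
  exact mul_pos (Real.sqrt_pos.2 ht) (slitTip_im_pos c)

theorem norm_slitRay (c t : ℝ) : ‖slitRay c t‖ = √t * tipModulus c := by
  rw [slitRay, norm_mul, norm_slitTip, Complex.norm_of_nonneg (Real.sqrt_nonneg t)]

/-- The argument of a ray point would force both distances in `norm_eq` to exceed their values at
absorption, contradicting its modulus. -/
theorem not_exists_trajectory_slitRay (c : ℝ) {s : ℝ} (hs : 0 < s) :
    ¬ ∃ g, IsLoewnerTrajectory (fun t => c * √t) (slitRay c s) s g := by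
  rintro ⟨g, hg⟩
  have hz := slitRay_im_pos c hs
  have hr := Real.sqrt_pos.2 hs
  have hw := hg.im_pos (continuous_mul_sqrt c).continuousOn hz (right_mem_Icc.2 hs.le)
  have harg := hg.arg_eq hs.le hz
  rw [slitRay, arg_mul_slitTip c hr] at harg
  have hd := (two_mul_growthConst_sub_pos c).ne'
  have ha := sub_pos.2 (lt_growthConst c)
  have ha' := growthConst_pos c
  have hsum : growthConst c * √s + (growthConst c - c) * √s =
      (2 * growthConst c - c) * √s := by ring
  obtain ⟨h1, h2⟩ := lt_norms_of_weighted_arg_eq (p := growthConst c * √s)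
    (q := (growthConst c - c) * √s) (by positivity)
    (rightWeight_pos c) (leftWeight_pos c) (rightWeight_add_leftWeight c) hw harg.symm
  rw [hsum, ← mul_assoc, rightWeight, div_mul_cancel₀ _ hd] at h1
  rw [hsum, ← mul_assoc, leftWeight, div_mul_cancel₀ _ hd] at h2
  have hn := hg.norm_eq hs.le hz
  rw [norm_slitRay, sqrt_mul_tipModulus] at hn
  refine hn.not_lt (mul_lt_mul'' ?_ ?_ (by positivity) (by positivity))
  · exact Real.rpow_lt_rpow (by positivity) h1 (rightWeight_pos c)
  · exact Real.rpow_lt_rpow (by positivity) h2 (leftWeight_pos c)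

/-- Take times at which the trajectory approaches λ, extract a limit τ, and pass to the limit in the
modulus and argument identities with w → c√τ. -/
theorem exists_eq_slitRay_of_not_exists_trajectory (c : ℝ) {t : ℝ} (ht : 0 ≤ t) {z : ℂ}
    (hz : 0 < z.im) (hno : ¬ ∃ g, IsLoewnerTrajectory (fun t => c * √t) z t g) :
    ∃ s ∈ Icc 0 t, slitRay c s = z := by
  have hlam := continuous_mul_sqrt c
  choose s hs g hg hd using fun n : ℕ => exists_trajectory_near_driving hlam.continuousOn ht hz hno
    (show (0 : ℝ) < 1 / ((n : ℝ) + 1) by positivity)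
  obtain ⟨τ, hτ, φ, hφ, hlim⟩ := isCompact_Icc.tendsto_subseq
    fun n => Ico_subset_Icc_self (hs n)
  refine ⟨τ, hτ, ?_⟩
  set w : ℕ → ℂ := fun n => g (φ n) (s (φ n)) with hw
  have hsq : ∀ a : ℝ, Tendsto (fun n => ((a * √(s (φ n)) : ℝ) : ℂ)) atTop
      (𝓝 ((a * √τ : ℝ) : ℂ)) := fun a =>
    ((Complex.continuous_ofReal.comp (continuous_mul_sqrt a)).tendsto τ).comp hlim
  have hwlim : Tendsto w atTop (𝓝 ((c * √τ : ℝ) : ℂ)) := by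
    have h1 : Tendsto (fun n => w n - ((c * √(s (φ n)) : ℝ) : ℂ)) atTop (𝓝 0) :=
      squeeze_zero_norm (fun n => (hd (φ n)).le)
        (tendsto_one_div_add_atTop_nhds_zero_nat.comp hφ.tendsto_atTop)
    simpa using h1.add (hsq c)
  have hwim : ∀ n, 0 < (w n).im := fun n =>
    (hg (φ n)).im_pos hlam.continuousOn hz (right_mem_Icc.2 (hs (φ n)).1)
  have hR : Tendsto (fun n => w n - ((growthConst c * √(s (φ n)) : ℝ) : ℂ)) atTop
      (𝓝 ((-((growthConst c - c) * √τ) : ℝ) : ℂ)) := by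
    convert hwlim.sub (hsq (growthConst c)) using 2
    push_cast
    ring
  have hL : Tendsto (fun n => w n + (((growthConst c - c) * √(s (φ n)) : ℝ) : ℂ)) atTop
      (𝓝 ((growthConst c * √τ : ℝ) : ℂ)) := by
    convert hwlim.add (hsq (growthConst c - c)) using 2
    push_cast
    ring
  have ha := sub_pos.2 (lt_growthConst c)
  have ha' := growthConst_pos c
  have hnorm : ‖z‖ = √τ * tipModulus c := by
    have h1 := (hR.norm.rpow_const (Or.inr (rightWeight_pos c).le)).mul
      (hL.norm.rpow_const (Or.inr (leftWeight_pos c).le))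
    have h2 := h1.congr fun n => ((hg (φ n)).norm_eq (hs (φ n)).1 hz).symm
    rw [tendsto_nhds_unique tendsto_const_nhds h2, sqrt_mul_tipModulus, Complex.norm_real,
      Complex.norm_real, norm_neg, Real.norm_of_nonneg (by positivity),
      Real.norm_of_nonneg (by positivity)]
  have hτ0 : 0 < √τ := by
    have h0 : 0 < ‖z‖ := norm_pos_iff.2 fun h => by simp [h] at hz
    rw [hnorm] at h0
    exact pos_of_mul_pos_left h0 (tipModulus_pos c).le
  have harg : z.arg = Real.pi * rightWeight c := by
    have hneg : -((growthConst c - c) * √τ) < 0 := by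
      have := mul_pos ha hτ0
      linarith
    -- The limit is on the branch cut of `arg`, but the approach is from the upper half-plane, where
    -- `arg` tends to π.
    have h1 : Tendsto (fun n => (w n - ((growthConst c * √(s (φ n)) : ℝ) : ℂ)).arg) atTop
        (𝓝 ((-((growthConst c - c) * √τ) : ℝ) : ℂ).arg) := by
      refine (Complex.continuousWithinAt_arg_of_re_neg_of_im_zero (by simpa using hneg)
        (Complex.ofReal_im _)).tendsto.comp (tendsto_nhdsWithin_iff.2 ⟨hR, ?_⟩)
      exact Eventually.of_forall fun n => by simpa using (hwim n).le
    have h2 : Tendsto (fun n => (w n + (((growthConst c - c) * √(s (φ n)) : ℝ) : ℂ)).arg) atTop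
        (𝓝 ((growthConst c * √τ : ℝ) : ℂ).arg) :=
      (Complex.continuousAt_arg (Complex.ofReal_mem_slitPlane.2 (mul_pos ha' hτ0))).tendsto.comp hL
    have h3 := (h1.const_mul (rightWeight c)).add (h2.const_mul (leftWeight c))
    have h4 := h3.congr fun n => ((hg (φ n)).arg_eq (hs (φ n)).1 hz).symm
    rw [tendsto_nhds_unique tendsto_const_nhds h4, Complex.arg_ofReal_of_neg hneg,
      Complex.arg_ofReal_of_nonneg (by positivity)]
    ring
  refine Complex.ext_norm_arg ?_ ?_
  · rw [norm_slitRay, hnorm]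
  · rw [slitRay, arg_mul_slitTip c hτ0, harg]

theorem loewnerDomain_mul_sqrt (c : ℝ) {t : ℝ} (ht : 0 ≤ t) :
    loewnerDomain (fun t => c * √t) t = {z : ℂ | 0 < z.im} \ slitRay c '' Icc 0 t := by
  ext z
  refine ⟨fun ⟨hz, g, hg⟩ => ⟨hz, ?_⟩, fun ⟨hz, hmem⟩ => ⟨hz, ?_⟩⟩
  · rintro ⟨s, hs, rfl⟩
    have hs0 : 0 < s := by
      rcases hs.1.eq_or_lt with h | h
      · simp [← h, slitRay] at hz
      · exact h
    exact not_exists_trajectory_slitRay c hs0 ⟨g, hg.restrict hs.2⟩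
  · by_contra hno
    exact hmem (exists_eq_slitRay_of_not_exists_trajectory c ht hz hno)

theorem isQuasiconformal_mulLeft₀ {a : ℂ} (ha : a ≠ 0) :
    IsQuasiconformal (Homeomorph.mulLeft₀ a ha) := by
  refine ⟨1, fun z => Eventually.of_forall fun r w w' hw hw' => ?_⟩
  simp only [Homeomorph.coe_mulLeft₀]
  rw [← mul_sub, ← mul_sub, norm_mul, norm_mul, hw, hw', one_mul]

theorem isQuasislit_slitRay (c : ℝ) {t : ℝ} (ht : 0 < t) :
    IsQuasislit 0 (slitRay c '' Icc 0 t) := by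
  have htip := slitTip_im_pos c
  refine ⟨⟨0, left_mem_Icc.2 ht.le, by simp [slitRay]⟩, ?_, |(slitTip c).re| / (slitTip c).im, ?_⟩
  · have hne : slitRay c t ≠ 0 := fun h => by
      have := slitRay_im_pos c ht
      simp [h] at this
    -- Multiplication by the endpoint of the arc maps [0, 1] onto it; time s corresponds to the
    -- parameter √s / √t.
    refine ⟨_, isQuasiconformal_mulLeft₀ hne, ?_⟩
    ext z
    constructor
    · rintro ⟨s, hs, rfl⟩
      refine ⟨√s / √t, ⟨by positivity, ?_⟩, ?_⟩
      · exact div_le_one_of_le₀ (Real.sqrt_le_sqrt hs.2) (Real.sqrt_nonneg t)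
      · have : (√t : ℂ) ≠ 0 := mod_cast (Real.sqrt_pos.2 ht).ne'
        simp only [Homeomorph.coe_mulLeft₀, slitRay]
        push_cast
        field_simp
    · rintro ⟨s, hs, rfl⟩
      refine ⟨s ^ 2 * t, ⟨by positivity, ?_⟩, ?_⟩
      · have : s ^ 2 ≤ 1 := pow_le_one₀ hs.1 hs.2
        nlinarith
      · simp only [Homeomorph.coe_mulLeft₀, slitRay]
        rw [Real.sqrt_mul (sq_nonneg s), Real.sqrt_sq hs.1]
        push_cast
        ring
  · rintro z ⟨s, -, rfl⟩
    rw [slitRay_re, slitRay_im, sub_zero, abs_mul, abs_of_nonneg (Real.sqrt_nonneg s)]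
    apply le_of_eq
    field_simp

theorem generatesQuasislits_mul_sqrt (c : ℝ) (T : ℝ≥0∞) :
    GeneratesQuasislits (fun t => c * √t) T (slitRay c) where
  continuousOn := ((Complex.continuous_ofReal.comp Real.continuous_sqrt).mul
    continuous_const).continuousOn
  injOn s hs t ht h := by
    have := congrArg Complex.im h
    rw [slitRay_im, slitRay_im] at this
    exact (Real.sqrt_inj hs.1 ht.1).1 (mul_right_cancel₀ (slitTip_im_pos c).ne' this)
  root := by simp [slitRay]
  im_pos t _ ht := slitRay_im_pos c ht
  domain_eq t ht := loewnerDomain_mul_sqrt c ht.1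
  quasislit t _ ht := by simpa using isQuasislit_slitRay c ht

/-! ### Sharpness -/

theorem isRightSingularSolution_growthConst_mul_sqrt (c : ℝ) (T : ℝ≥0∞) :
    IsRightSingularSolution (fun t => c * √t) T (fun t => growthConst c * √t) where
  continuousOn := (continuous_mul_sqrt _).continuousOn
  init := by simp
  lt t _ ht := mul_lt_mul_of_pos_right (lt_growthConst c) (Real.sqrt_pos.2 ht)
  deriv t _ ht := by
    rw [← sub_mul]
    exact hasDerivAt_growthConst_mul_sqrt c ht

/-- Points a√t + i/(n+1) have preimages under the flow, and `norm_eq` shows that these tend to the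
root because the factor ‖w - a√t‖ vanishes in the limit. -/
theorem growthConst_mul_sqrt_mem_slitImage (c : ℝ) {t : ℝ} (ht : 0 ≤ t) :
    growthConst c * √t ∈ slitImage (fun t => c * √t) (slitRay c) t := by
  have hlam := continuous_mul_sqrt c
  refine ⟨slitRay c 0, ⟨0, left_mem_Icc.2 ht, rfl⟩, ?_⟩
  set a : ℂ := ((growthConst c * √t : ℝ) : ℂ) with ha
  set w : ℕ → ℂ := fun n => a + ((1 / ((n : ℝ) + 1) : ℝ) : ℂ) * Complex.I with hw
  have hwim : ∀ n, 0 < (w n).im := fun n => by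
    have : (0 : ℝ) < 1 / ((n : ℝ) + 1) := by positivity
    rw [Complex.add_im, Complex.ofReal_im, zero_add, Complex.im_ofReal_mul, Complex.I_im, mul_one]
    exact this
  choose z g hz hg hgt using fun n => exists_trajectory_ending_at hlam.continuousOn ht (hwim n)
  have hwlim : Tendsto w atTop (𝓝 a) := by
    have h1 := (Complex.continuous_ofReal.tendsto 0).comp
      tendsto_one_div_add_atTop_nhds_zero_nat
    simpa [Function.comp_def, hw] using (h1.mul_const Complex.I).const_add a
  have hzlim : Tendsto z atTop (𝓝 0) := by
    have h1 := ((hwlim.sub_const a).norm.rpow_const (Or.inr (rightWeight_pos c).le)).mul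
      ((hwlim.add_const (((growthConst c - c) * √t : ℝ) : ℂ)).norm.rpow_const
        (Or.inr (leftWeight_pos c).le))
    rw [sub_self, norm_zero, Real.zero_rpow (rightWeight_pos c).ne', zero_mul] at h1
    refine tendsto_zero_iff_norm_tendsto_zero.2 (h1.congr fun n => ?_)
    rw [(hg n).norm_eq ht (hz n), hgt n]
  have h0 : slitRay c 0 = 0 := by simp [slitRay]
  rw [h0]
  refine MapClusterPt.of_comp (φ := z) (p := atTop)
    (tendsto_nhdsWithin_iff.2 ⟨hzlim, Eventually.of_forall fun n => ⟨hz n, g n, hg n⟩⟩)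
    (Tendsto.mapClusterPt (hwlim.congr fun n => ?_))
  rw [Function.comp_apply, (hg n).loewnerMap_eq hlam.continuousOn (hz n) ht, hgt n]

theorem rightEndpoint_mul_sqrt {c : ℝ} (hc : 0 ≤ c) {t : ℝ} (ht : 0 ≤ t) :
    rightEndpoint (fun t => c * √t) (slitRay c) t = growthConst c * √t := by
  have hle : ∀ x ∈ slitImage (fun t => c * √t) (slitRay c) t, x ≤ growthConst c * √t :=
    fun x hx => by
      -- The slit image does not depend on T, so T = ∞ covers every t ≥ 0.
      have := (generatesQuasislits_mul_sqrt c ⊤).le_of_mem_slitImage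
        (continuous_mul_sqrt c).continuousOn (c := c) (fun u _ => by
          rw [Real.sqrt_zero, mul_zero, sub_zero, abs_of_nonneg (by positivity)])
        ⟨ht, ENNReal.ofReal_lt_top⟩ hx
      simpa using this
  have hmem := growthConst_mul_sqrt_mem_slitImage c ht
  exact (csSup_le ⟨_, hmem⟩ hle).antisymm (le_csSup ⟨_, hle⟩ hmem)

theorem abs_sqrt_sub_sqrt_le {s t : ℝ} (hs : 0 ≤ s) (ht : 0 ≤ t) : |√s - √t| ≤ √|s - t| := by
  refine Real.abs_le_sqrt ?_
  have h1 : s - t = (√s - √t) * (√s + √t) := by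
    linear_combination -Real.sq_sqrt hs + Real.sq_sqrt ht
  have h2 : |√s - √t| ≤ √s + √t := by
    rw [abs_le]
    constructor <;> linarith [Real.sqrt_nonneg s, Real.sqrt_nonneg t]
  rw [h1, abs_mul, abs_of_nonneg (show 0 ≤ √s + √t by positivity), ← sq_abs, sq]
  gcongr

theorem hasLipHalfNorm_mul_sqrt (c : ℝ≥0) {T : ℝ≥0∞} (hT : 0 < T) :
    HasLipHalfNorm (fun t => c * √t) T c := by
  have hH : HolderWith c (1 / 2) (fun t : timeInterval T => (c : ℝ) * √(t : ℝ)) := by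
    intro s t
    rw [edist_nndist, edist_nndist, ← ENNReal.coe_rpow_of_nonneg _ (by positivity),
      ← ENNReal.coe_mul, ENNReal.coe_le_coe, ← NNReal.coe_le_coe]
    push_cast
    rw [Subtype.dist_eq, Real.dist_eq, Real.dist_eq, ← mul_sub, abs_mul, NNReal.abs_eq,
      ← Real.sqrt_eq_rpow]
    gcongr
    exact abs_sqrt_sub_sqrt_le s.2.1 t.2.1
  refine ⟨hH.memHolder, hH.nnholderNorm_le.antisymm ?_⟩
  -- Apply the Hölder bound with the least constant to the pair 0, t: there c√t ≤ C√t, so C ≥ c.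
  have h1 : HasLipHalfNorm (fun t => c * √t) T
    (nnHolderNorm (1 / 2) (fun t : timeInterval T => (c : ℝ) * √(t : ℝ))) := ⟨hH.memHolder, rfl⟩
  obtain ⟨t, ht, ht0⟩ := ((eventually_mem_timeInterval hT).and self_mem_nhdsWithin).exists
  have h2 := h1.abs_sub_le (zero_mem_timeInterval hT) ht
  have ht0' : 0 < t := ht0
  rw [Real.sqrt_zero, mul_zero, sub_zero, sub_zero, abs_of_nonneg (by positivity),
    abs_of_pos ht0'] at h2
  exact_mod_cast le_of_mul_le_mul_right h2 (Real.sqrt_pos.2 ht0')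

theorem sqrtGrowth_eq {x : ℝ → ℝ} {a : ℝ} (h : ∀ᶠ t in 𝓝[>] 0, x t = x 0 + a * √t) :
    sqrtGrowth x = (a : EReal) := by
  have hev : (fun t : ℝ => (((x t - x 0) / √t : ℝ) : EReal)) =ᶠ[𝓝[>] 0] fun _ => (a : EReal) := by
    filter_upwards [h, self_mem_nhdsWithin] with t ht h0
    rw [ht, add_sub_cancel_left, mul_div_cancel_right₀ _ (Real.sqrt_pos.2 h0).ne']
  rw [sqrtGrowth, limsup_congr hev, limsup_const]

theorem theorem3p1 :
    (∀ (T : ℝ≥0∞) (lam : ℝ → ℝ) (c : ℝ≥0) (γ : ℝ → ℂ),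
      0 < T → HasLipHalfNorm lam T c → GeneratesQuasislits lam T γ →
        sqrtGrowth (rightEndpoint lam γ) ≤ (((c + √((c : ℝ) ^ 2 + 16)) / 2 : ℝ) : EReal) ∧
        ∀ x : ℝ → ℝ, IsRightSingularSolution lam T x →
          sqrtGrowth x ≤ (((c + √((c : ℝ) ^ 2 + 16)) / 2 : ℝ) : EReal)) ∧
    (∀ (T : ℝ≥0∞) (c : ℝ≥0), 0 < T →
      HasLipHalfNorm (fun t => c * √t) T c ∧
      ∃ γ : ℝ → ℂ, GeneratesQuasislits (fun t => c * √t) T γ ∧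
        IsRightSingularSolution (fun t => c * √t) T
          (fun t => (c + √((c : ℝ) ^ 2 + 16)) / 2 * √t) ∧
        (∀ t ∈ timeInterval T,
          rightEndpoint (fun t => c * √t) γ t = (c + √((c : ℝ) ^ 2 + 16)) / 2 * √t) ∧
        sqrtGrowth (rightEndpoint (fun t => c * √t) γ) =
          (((c + √((c : ℝ) ^ 2 + 16)) / 2 : ℝ) : EReal)) := by
  refine ⟨fun T lam c γ hT hlam hγ => ?_, fun T c hT => ⟨hasLipHalfNorm_mul_sqrt c hT, slitRay c,
    generatesQuasislits_mul_sqrt c T, isRightSingularSolution_growthConst_mul_sqrt c T,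
    fun t ht => rightEndpoint_mul_sqrt c.coe_nonneg ht.1, ?_⟩⟩
  · have hbd : ∀ u ∈ timeInterval T, |lam u - lam 0| ≤ c * √u := fun u hu => by
      have := hlam.abs_sub_le (zero_mem_timeInterval hT) hu
      rwa [sub_zero, abs_of_nonneg hu.1] at this
    refine ⟨sqrtGrowth_le (a := growthConst c) ?_, fun x hx =>
      sqrtGrowth_le (a := growthConst c) ?_⟩
    · filter_upwards [eventually_mem_timeInterval hT] with t ht
      rw [hγ.rightEndpoint_zero hT hlam.continuousOn hbd]
      exact hγ.rightEndpoint_le hlam.continuousOn hbd ht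
    · filter_upwards [eventually_mem_timeInterval hT] with t ht
      rw [hx.init]
      exact hx.le hbd ht
  · refine sqrtGrowth_eq (a := growthConst c) ?_
    filter_upwards [self_mem_nhdsWithin] with t ht
    rw [rightEndpoint_mul_sqrt c.coe_nonneg (le_of_lt ht), rightEndpoint_mul_sqrt c.coe_nonneg le_rfl]
    simp
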